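/- **Setting.** Let $\Omega\subset\mathbb R^n$ be measurable (e.g. a bounded domain), $\alpha:\mathbb R^n\times\mathbb R^n\to\mathbb R^n$ measurable and anti-symmetric, $\omega:\mathbb R^n\times\mathbb R^n\to[0,\infty)$ measurable and symmetric, and let $A:\mathbb R^n\to\mathbb R^{n\times n}$ be measurable, symmetric, with $\lambda_{\min}|\xi|^2\le \xi\cdot A(x)\xi\le\lambda_{\max}|\xi|^2$ for all $x,\xi$, where $0<\lambda_{\min}\le\lambda_{\max}<\infty$; let $A^{1/2}(x)$ be a symmetric square root of $A(x)$. Put $$\mathcal G_\omega u(x)=\mathrm{p.v.}\!\int_{\mathbb R^n}\omega(x,y)(u(y)-u(x))\alpha(x,y)\,dy,\qquad \mathcal B_{\omega;A}(u,v)=\int_{\mathbb R^n}\mathcal G_\omega v\cdot A\,\mathcal G_\omega u\,dx .$$ With $W(x,y)=A^{1/2}(x)\omega(x,y)$ the equivalence kernel $\gamma=\gamma_{\rm eq}(\cdot,\cdot;A^{1/2}\omega,\alpha)$ is given by $$2\gamma(x,y)=\mathrm{p.v.}\!\int_{\mathbb R^n}\big[W(x,y)\alpha(x,y)\cdot W(x,z)\alpha(x,z)+W(z,y)\alpha(z,y)\cdot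 W(z,x)\alpha(x,z)+W(y,z)\alpha(z,y)\cdot W(y,x)\alpha(x,y)\big]dz .$$ Principal values are limits as $\varepsilon\downarrow0$ of the integrals with $\omega(x,y)$ replaced by $\omega_\varepsilon(x,y)=\omega(x,y)\mathbf 1_{|x-y|\ge\varepsilon}$; $\mathcal G_{\omega_\varepsilon}$ and $\gamma^\varepsilon$ denote these truncated objects. Let $$\mathcal B(u,v)=\iint (u(y)-u(x))(v(y)-v(x))\gamma(x,y)\,dy\,dx,\qquad |||v|||^2=\iint|v(y)-v(x)|^2|\gamma(x,y)|\,dy\,dx,$$ $$V_\Omega=\{v\in L^2(\mathbb R^n):|||v|||<\infty,\ v=0\text{ a.e. on }\mathbb R^n\setminus\Omega\},\qquad \|v\|_V^2=\|v\|_{L^2}^2+|||v|||^2,$$ and let $V_\Omega'$ be the dual of $V_\Omega$ with the operator norm. It is assumed that these integrals converge: (i) for all $v\in V_\Omega$ and $\varepsilon>0$, $\iiint|v(y)-v(x)|^2\,|\omega_\varepsilon\alpha|(x,y)\,|\omega_\varepsilon\alpha|(x,z)\,dz\,dy\,dx<\infty$; (ii) $\gamma^\varepsilon\to\gamma$ a.e.,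 and there is a measurable $g$ with $|\gamma^\varepsilon|\le g$ a.e. for all small $\varepsilon$ and $\iint|v(y)-v(x)|^2g(x,y)\,dy\,dx<\infty$ for all $v\in V_\Omega$; (iii) $\mathcal G_{\omega_\varepsilon}v\to\mathcal G_\omega v$ a.e. and in $L^2$ for all $v\in V_\Omega$. **Theorem.** Suppose that $\mathcal B$ is continuous on $V_\Omega$ and weakly coercive, i.e. $\mathcal B(v,v)+\lambda\|v\|_{L^2}^2\ge c\|v\|_V^2$ on $V_\Omega$ for some $c>0$, $\lambda\in\mathbb R$. Let $T>0$, $f\in L^2(0,T;V_\Omega')$, and let $u_0$ be in the $L^2$-closure of $V_\Omega$ (for instance $u_0\in V_\Omega$). Then there is a unique $u^*\in L^2(0,T;V_\Omega)$ that solves $$(\partial_tu,v)_{L^2}+\mathcal B_{\omega;A}(u,v)=\langle f,v\rangle\quad\forall v\in V_\Omega,\qquad u(0)=u_0,$$ in the sense that for all $v\in V_\Omega$ and $\varphi\in C_c^\infty((-\infty,T))$ $$-\int_0^T(u,v)_{L^2}\,\varphi'\,dt+\int_0^T\mathcal B_{\omega;A}(u,v)\,\varphi\,dt=\int_0^T\langle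 f,v\rangle\,\varphi\,dt+(u_0,v)_{L^2}\,\varphi(0).$$ It has a representative in $C([0,T];L^2(\mathbb R^n))$, again written $u^*$, with $u^*(0)=u_0$. If moreover $\mathcal B$ is coercive, $\mathcal B(v,v)\ge C_{\rm coer}|||v|||^2$ on $V_\Omega$ with $C_{\rm coer}>0$, and the Poincaré inequality $\|v\|_V\le C_p|||v|||$ holds on $V_\Omega$, then for all $t\in(0,T]$ $$\|u^*(t)\|^2_{L^2}+C_{\rm coer}\int_0^t|||u^*(s)|||^2ds\le\|u_0\|^2_{L^2}+\frac{C_p^2}{C_{\rm coer}}\int_0^t\|f(s)\|_{V'_\Omega}^2ds .$$ If the Poincaré inequality is given in the form $\|v\|_{L^2}\le C_p|||v|||$, the same holds with $1+C_p^2$ in place of $C_p^2$. -/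

import Mathlib

open MeasureTheory Filter Topology Set
open scoped ENNReal InnerProductSpace

noncomputable section

/-- The Euclidean space of dimension `n`. -/
abbrev Rn (n : ℕ) : Type := EuclideanSpace ℝ (Fin n)

/-- The real Hilbert space of square integrable functions on the whole space. -/
abbrev L2 (n : ℕ) : Type := Lp ℝ 2 (volume : Measure (Rn n))

/-! ### Nonlocal operators and the equivalence kernel -/

section Kernels

variable {n : ℕ}

/-- A two-point weight (scalar or tensor valued) with the ball of radius `ε` around the diagonal
cut out. -/
def truncWeight {M : Type*} [Zero M] (ε : ℝ) (w : Rn n → Rn n → M) (x y : Rn n) : M :=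
  open Classical in if ε ≤ dist x y then w x y else 0

/-- The weighted nonlocal gradient `x ↦ ∫ ω(x,y) (u(y) - u(x)) α(x,y) dy`,
as a Lebesgue integral. -/
def weightedGrad (ω : Rn n → Rn n → ℝ) (α : Rn n → Rn n → Rn n) (u : Rn n → ℝ)
    (x : Rn n) : Rn n :=
  ∫ y, (ω x y * (u y - u x)) • α x y

/-- The weighted nonlocal gradient as a principal value: the limit, as `ε ↓ 0`, of the integrals
over `|y - x| ≥ ε`. -/
def pvGrad (ω : Rn n → Rn n → ℝ) (α : Rn n → Rn n → Rn n) (u : Rn n → ℝ)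
    (x : Rn n) : Rn n :=
  limUnder (𝓝[>] (0 : ℝ)) fun ε => weightedGrad (truncWeight ε ω) α u x

/-- The anisotropic weighted form `∫ G_ω v(x) · A(x) G_ω u(x) dx`. -/
def anisoForm (ω : Rn n → Rn n → ℝ) (α : Rn n → Rn n → Rn n) (A : Rn n → Rn n →L[ℝ] Rn n)
    (u v : Rn n → ℝ) : ℝ :=
  ∫ x, ⟪pvGrad ω α v x, A x (pvGrad ω α u x)⟫_ℝ

/-- The equivalence kernel of a tensor weight `W`, not necessarily symmetric in its two points,
and of `α`, as a Lebesgue integral: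
`2 γ(x,y) = ∫ [ W(x,y)α(x,y)·W(x,z)α(x,z) + W(z,y)α(z,y)·W(z,x)α(x,z)
  + W(y,z)α(z,y)·W(y,x)α(x,y) ] dz`. -/
def eqKernelLebesgue (W : Rn n → Rn n → Rn n →L[ℝ] Rn n) (α : Rn n → Rn n → Rn n)
    (x y : Rn n) : ℝ :=
  (1 / 2 : ℝ) * ∫ z, (⟪W x y (α x y), W x z (α x z)⟫_ℝ + ⟪W z y (α z y), W z x (α x z)⟫_ℝ
    + ⟪W y z (α z y), W y x (α x y)⟫_ℝ)

/-- The equivalence kernel as a principal value: neighbourhoods of the singular points `z = x` and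
`z = y` are cut out of the integral, and their radius tends to zero. -/
def eqKernel (W : Rn n → Rn n → Rn n →L[ℝ] Rn n) (α : Rn n → Rn n → Rn n) (x y : Rn n) : ℝ :=
  limUnder (𝓝[>] (0 : ℝ)) fun ε => eqKernelLebesgue (truncWeight ε W) α x y

/-- The tensor weight `A^{1/2}(x) ω(x,y)`, where `S` is the square root of `A`. -/
def tensorWeight (S : Rn n → Rn n →L[ℝ] Rn n) (ω : Rn n → Rn n → ℝ) (x y : Rn n) :
    Rn n →L[ℝ] Rn n :=
  ω x y • S x

/-- The unweighted form `∫∫ (u(y) - u(x)) (v(y) - v(x)) γ(x,y) dy dx` of a kernel `γ`. -/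
def unweightedForm (γ : Rn n → Rn n → ℝ) (u v : Rn n → ℝ) : ℝ :=
  ∫ p : Rn n × Rn n, (u p.2 - u p.1) * (v p.2 - v p.1) * γ p.1 p.2

end Kernels

/-! ### The energy space -/

section EnergySpace

variable {n : ℕ}

/-- The two-point difference `(x,y) ↦ v(y) - v(x)`. -/
def twoPointDiff (v : Rn n → ℝ) (p : Rn n × Rn n) : ℝ := v p.2 - v p.1

/-- The measure `|γ(x,y)| dy dx`. -/
def kernelMeasure (γ : Rn n → Rn n → ℝ) : Measure (Rn n × Rn n) :=
  (volume : Measure (Rn n × Rn n)).withDensity fun p => ‖γ p.1 p.2‖ₑ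

theorem twoPointDiff_congr (γ : Rn n → Rn n → ℝ) {u v : Rn n → ℝ} (h : u =ᵐ[volume] v) :
    twoPointDiff u =ᵐ[kernelMeasure γ] twoPointDiff v := by
  have h1 : ∀ᵐ p : Rn n × Rn n, u p.1 = v p.1 :=
    (Measure.quasiMeasurePreserving_fst (μ := volume) (ν := volume)).ae h
  have h2 : ∀ᵐ p : Rn n × Rn n, u p.2 = v p.2 :=
    (Measure.quasiMeasurePreserving_snd (μ := volume) (ν := volume)).ae h
  refine (withDensity_absolutelyContinuous _ _).ae_le ?_
  filter_upwards [h1, h2] with p hp1 hp2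
  simp [twoPointDiff, hp1, hp2]

theorem twoPointDiff_add (γ : Rn n → Rn n → ℝ) (u v : L2 n) :
    twoPointDiff (u + v : L2 n) =ᵐ[kernelMeasure γ] twoPointDiff u + twoPointDiff v := by
  refine (twoPointDiff_congr γ (Lp.coeFn_add u v)).trans (Eventually.of_forall fun p => ?_)
  simp only [twoPointDiff, Pi.add_apply]; ring

theorem twoPointDiff_smul (γ : Rn n → Rn n → ℝ) (c : ℝ) (u : L2 n) :
    twoPointDiff (c • u : L2 n) =ᵐ[kernelMeasure γ] c • twoPointDiff u := by
  refine (twoPointDiff_congr γ (Lp.coeFn_smul c u)).trans (Eventually.of_forall fun p => ?_)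
  simp only [twoPointDiff, Pi.smul_apply, smul_eq_mul]; ring

/-- The functions `v ∈ L²` that vanish almost everywhere outside `Ω` and whose energy
`∫∫ |v(y) - v(x)|² |γ(x,y)| dy dx` is finite. -/
def energySubmodule (γ : Rn n → Rn n → ℝ) (Ω : Set (Rn n)) : Submodule ℝ (L2 n) where
  carrier := {v | (∀ᵐ x, x ∉ Ω → v x = 0) ∧ MemLp (twoPointDiff v) 2 (kernelMeasure γ)}
  zero_mem' := by
    refine ⟨?_, ?_⟩
    · filter_upwards [Lp.coeFn_zero ℝ 2 (volume : Measure (Rn n))] with x hx _ using hx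
    · refine (memLp_congr_ae (g := fun _ => (0 : ℝ)) ?_).2 MemLp.zero'
      refine (twoPointDiff_congr γ (Lp.coeFn_zero ℝ 2 (volume : Measure (Rn n)))).trans ?_
      exact Eventually.of_forall fun p => by simp [twoPointDiff]
  add_mem' := by
    rintro u v ⟨hu, hu'⟩ ⟨hv, hv'⟩
    refine ⟨?_, (memLp_congr_ae (twoPointDiff_add γ u v)).2 (hu'.add hv')⟩
    filter_upwards [hu, hv, Lp.coeFn_add u v] with x h1 h2 h3 hx
    rw [h3, Pi.add_apply, h1 hx, h2 hx, add_zero]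
  smul_mem' := by
    rintro c u ⟨hu, hu'⟩
    refine ⟨?_, (memLp_congr_ae (twoPointDiff_smul γ c u)).2 (hu'.const_smul c)⟩
    filter_upwards [hu, Lp.coeFn_smul c u] with x h1 h3 hx
    rw [h3, Pi.smul_apply, h1 hx, smul_zero]

/-- The energy space `V_Ω` of a kernel `γ`. -/
def EnergySpace (γ : Rn n → Rn n → ℝ) (Ω : Set (Rn n)) : Type := energySubmodule γ Ω

instance (γ : Rn n → Rn n → ℝ) (Ω : Set (Rn n)) : AddCommGroup (EnergySpace γ Ω) :=
  inferInstanceAs (AddCommGroup (energySubmodule γ Ω))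

instance (γ : Rn n → Rn n → ℝ) (Ω : Set (Rn n)) : Module ℝ (EnergySpace γ Ω) :=
  inferInstanceAs (Module ℝ (energySubmodule γ Ω))

/-- The inclusion of the energy space in `L²`. -/
def EnergySpace.toL2 {γ : Rn n → Rn n → ℝ} {Ω : Set (Rn n)} : EnergySpace γ Ω →ₗ[ℝ] L2 n :=
  (energySubmodule γ Ω).subtype

/-- The inner product `(u,v)_{L²} + ∫∫ (u(y) - u(x)) (v(y) - v(x)) |γ(x,y)| dy dx`. -/
@[reducible]
def energyCore (γ : Rn n → Rn n → ℝ) (Ω : Set (Rn n)) :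
    InnerProductSpace.Core ℝ (EnergySpace γ Ω) where
  inner u v := ⟪u.toL2, v.toL2⟫_ℝ
    + ∫ p, twoPointDiff u.toL2 p * twoPointDiff v.toL2 p ∂(kernelMeasure γ)
  conj_inner_symm u v := by
    simp only [conj_trivial]
    rw [real_inner_comm]
    simp only [mul_comm]
  re_inner_nonneg u := by
    simp only [RCLike.re_to_real]
    exact add_nonneg real_inner_self_nonneg (integral_nonneg fun p => mul_self_nonneg _)
  add_left u v w := by
    have hu : MemLp (twoPointDiff u.toL2) 2 (kernelMeasure γ) := u.2.2
    have hv : MemLp (twoPointDiff v.toL2) 2 (kernelMeasure γ) := v.2.2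
    have hw : MemLp (twoPointDiff w.toL2) 2 (kernelMeasure γ) := w.2.2
    have key : ∫ p, twoPointDiff (u + v).toL2 p * twoPointDiff w.toL2 p ∂(kernelMeasure γ)
        = ∫ p, twoPointDiff u.toL2 p * twoPointDiff w.toL2 p ∂(kernelMeasure γ)
          + ∫ p, twoPointDiff v.toL2 p * twoPointDiff w.toL2 p ∂(kernelMeasure γ) := by
      refine Eq.trans ?_ (integral_add (hu.integrable_mul hw) (hv.integrable_mul hw))
      refine integral_congr_ae ?_
      rw [map_add]
      filter_upwards [twoPointDiff_add γ u.toL2 v.toL2] with p hp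
      simp only [hp, Pi.add_apply, add_mul]
    rw [key, map_add, inner_add_left]
    ring
  smul_left u v c := by
    have key : ∫ p, twoPointDiff (c • u).toL2 p * twoPointDiff v.toL2 p ∂(kernelMeasure γ)
        = c * ∫ p, twoPointDiff u.toL2 p * twoPointDiff v.toL2 p ∂(kernelMeasure γ) := by
      rw [← integral_const_mul]
      refine integral_congr_ae ?_
      rw [map_smul]
      filter_upwards [twoPointDiff_smul γ c u.toL2] with p hp
      rw [hp, Pi.smul_apply, smul_eq_mul, mul_assoc]
    simp only [conj_trivial]
    rw [key, map_smul, real_inner_smul_left]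
    ring
  definite u h := by
    have h1 : 0 ≤ ⟪u.toL2, u.toL2⟫_ℝ := real_inner_self_nonneg
    have h2 : 0 ≤ ∫ p, twoPointDiff u.toL2 p * twoPointDiff u.toL2 p ∂(kernelMeasure γ) :=
      integral_nonneg fun p => mul_self_nonneg _
    have h3 : ⟪u.toL2, u.toL2⟫_ℝ = 0 := by
      have h' : ⟪u.toL2, u.toL2⟫_ℝ
        + ∫ p, twoPointDiff u.toL2 p * twoPointDiff u.toL2 p ∂(kernelMeasure γ) = 0 := h
      linarith
    exact Subtype.ext (inner_self_eq_zero.1 h3)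

instance (γ : Rn n → Rn n → ℝ) (Ω : Set (Rn n)) : NormedAddCommGroup (EnergySpace γ Ω) :=
  (energyCore γ Ω).toNormedAddCommGroup

instance (γ : Rn n → Rn n → ℝ) (Ω : Set (Rn n)) : InnerProductSpace ℝ (EnergySpace γ Ω) :=
  InnerProductSpace.ofCore (energyCore γ Ω).toCore

variable {γ : Rn n → Rn n → ℝ} {Ω : Set (Rn n)}

/-- The energy norm `(∫∫ |v(y) - v(x)|² |γ(x,y)| dy dx)^{1/2}`, without the `L²` part. -/
def energyNorm (v : EnergySpace γ Ω) : ℝ :=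
  Real.sqrt (∫ p, twoPointDiff v.toL2 p ^ 2 ∂(kernelMeasure γ))

/-- The full norm is `‖v‖² = ‖v‖²_{L²} + |||v|||²`. -/
theorem EnergySpace.norm_sq_eq (v : EnergySpace γ Ω) :
    ‖v‖ ^ 2 = ‖v.toL2‖ ^ 2 + energyNorm v ^ 2 := by
  have h0 : 0 ≤ ∫ p, twoPointDiff v.toL2 p ^ 2 ∂(kernelMeasure γ) :=
    integral_nonneg fun p => sq_nonneg _
  rw [energyNorm, Real.sq_sqrt h0, ← real_inner_self_eq_norm_sq, ← real_inner_self_eq_norm_sq]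
  simp only [pow_two]
  rfl

/-- Continuity of the unweighted form on the energy space. -/
def IsContinuousForm (γ : Rn n → Rn n → ℝ) (Ω : Set (Rn n)) : Prop :=
  ∃ M : ℝ, ∀ u v : EnergySpace γ Ω, |unweightedForm γ u.toL2 v.toL2| ≤ M * ‖u‖ * ‖v‖

/-- Weak coercivity of the unweighted form (a Gårding inequality). -/
def IsWeaklyCoerciveForm (γ : Rn n → Rn n → ℝ) (Ω : Set (Rn n)) : Prop :=
  ∃ c > 0, ∃ l : ℝ, ∀ v : EnergySpace γ Ω,
    c * ‖v‖ ^ 2 ≤ unweightedForm γ v.toL2 v.toL2 + l * ‖v.toL2‖ ^ 2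

/-- Coercivity of the unweighted form in the energy norm, with constant `C`. -/
def IsCoerciveForm (γ : Rn n → Rn n → ℝ) (Ω : Set (Rn n)) (C : ℝ) : Prop :=
  0 < C ∧ ∀ v : EnergySpace γ Ω, C * energyNorm v ^ 2 ≤ unweightedForm γ v.toL2 v.toL2

end EnergySpace

/-! ### The convergence of the integrals, and weak solutions -/

section Problem

variable {n : ℕ}

/-- Convergence of the integrals that define the weighted gradient, the equivalence kernel and the
energies. Only absolute convergence of the truncated integrals, and convergence of the truncated
objects as `ε ↓ 0`, are asked for; nothing is said about the two bilinear forms. -/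
structure IntegralsConverge (S : Rn n → Rn n →L[ℝ] Rn n) (ω : Rn n → Rn n → ℝ)
    (α : Rn n → Rn n → Rn n) (Ω : Set (Rn n)) : Prop where
  /-- The truncated energies converge absolutely, as triple integrals. -/
  truncated : ∀ v ∈ energySubmodule (eqKernel (tensorWeight S ω) α) Ω, ∀ ε > 0,
    ∫⁻ x, ∫⁻ y, ∫⁻ z, ‖v y - v x‖ₑ ^ 2 * ‖truncWeight ε ω x y • α x y‖ₑ
      * ‖truncWeight ε ω x z • α x z‖ₑ < ∞
  /-- The principal value that defines the kernel exists almost everywhere. -/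
  kernel : ∀ᵐ p : Rn n × Rn n, Tendsto
    (fun ε => eqKernelLebesgue (truncWeight ε (tensorWeight S ω)) α p.1 p.2) (𝓝[>] 0)
    (𝓝 (eqKernel (tensorWeight S ω) α p.1 p.2))
  /-- The truncated kernels have a common majorant of finite energy. -/
  majorant : ∃ g : Rn n × Rn n → ℝ≥0∞, Measurable g ∧
    (∀ᶠ ε in 𝓝[>] (0 : ℝ), ∀ᵐ p : Rn n × Rn n,
      ‖eqKernelLebesgue (truncWeight ε (tensorWeight S ω)) α p.1 p.2‖ₑ ≤ g p) ∧
    ∀ v ∈ energySubmodule (eqKernel (tensorWeight S ω) α) Ω,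
      ∫⁻ p : Rn n × Rn n, ‖v p.2 - v p.1‖ₑ ^ 2 * g p < ∞
  /-- The principal value that defines the gradient of `v` exists almost everywhere. -/
  gradient : ∀ v ∈ energySubmodule (eqKernel (tensorWeight S ω) α) Ω, ∀ᵐ x, Tendsto
    (fun ε => weightedGrad (truncWeight ε ω) α v x) (𝓝[>] 0) (𝓝 (pvGrad ω α v x))
  /-- It exists in `L²` as well. -/
  gradient_L2 : ∀ v ∈ energySubmodule (eqKernel (tensorWeight S ω) α) Ω, Tendsto
    (fun ε => eLpNorm (fun x => weightedGrad (truncWeight ε ω) α v x - pvGrad ω α v x) 2 volume)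
    (𝓝[>] 0) (𝓝 0)

/-- Weak solutions `u ∈ L²(0,T;V_Ω)` of `(∂ₜu,v) + B_{ω;A}(u,v) = f(v)` for all `v ∈ V_Ω`, with
`u(0) = u₀`. The time derivative is distributional: the equation is tested with
`φ ∈ C_c^∞((-∞,T))`, and the initial value enters through `φ(0)`. -/
structure IsWeakSolution (ω : Rn n → Rn n → ℝ) (α : Rn n → Rn n → Rn n)
    (A : Rn n → Rn n →L[ℝ] Rn n) {γ : Rn n → Rn n → ℝ} {Ω : Set (Rn n)} (T : ℝ)
    (f : ℝ → StrongDual ℝ (EnergySpace γ Ω)) (u₀ : L2 n) (u : ℝ → EnergySpace γ Ω) : Prop where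
  memLp : MemLp u 2 (volume.restrict (Ioo 0 T))
  weak : ∀ v : EnergySpace γ Ω, ∀ φ : ℝ → ℝ, ContDiff ℝ (⊤ : ℕ∞) φ → HasCompactSupport φ →
    tsupport φ ⊆ Iio T →
    -(∫ t in Ioo 0 T, ⟪(u t).toL2, v.toL2⟫_ℝ * deriv φ t)
      + ∫ t in Ioo 0 T, anisoForm ω α A (u t).toL2 v.toL2 * φ t
      = (∫ t in Ioo 0 T, f t v * φ t) + ⟪u₀, v.toL2⟫_ℝ * φ 0

end Problem

end

/-! The proof has two independent halves: an identity between the two bilinear forms, and an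
abstract parabolic theorem for weakly coercive forms.

Identity. With b = ω_ε α, the truncated anisotropic energy is the triple integral of (v(y) - v(x))
(u(z) - u(x)) k(x,y,z), where k(x,y,z) = b(x,y) · A(x) b(x,z) is symmetric in y and z. Polarising
and relabelling the points turns the product of differences into (u(y) - u(x)) (v(y) - v(x)),
against half the z-integral of k(x,y,z) - k(z,y,x) + k(y,x,z) (`integral_symmetrise`). Antisymmetry
of α identifies this with the truncated equivalence kernel. As ε tends to 0, one side converges
because the gradients converge in L², the other by dominated convergence
(`anisoForm_eq_unweightedForm`).

Parabolic theory. For j : V → H and a weakly coercive B, adding ε(w',v)_V makes the equation an ODE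
in V. If the data are smooth and compatible at time zero, w' solves the differentiated equation with
zero initial value, so it is bounded in L²(0,T;V) independently of ε and the added term is O(ε).
This yields C¹ functions with values in V whose residual is as close to f as desired
(`exists_approximate_solution`). By the energy estimate such functions are Cauchy in L²(0,T;V) and,
uniformly in time, in H; the limit inherits the weak equation, continuity and the a priori estimate
(`exists_weak_solution`).

Uniqueness. A solution with zero data is integrated twice in time; the result is smooth enough for
the energy estimate, hence vanishes, and so does its second derivative
(`ae_eq_zero_of_weak_solution`). -/

noncomputable section

/-! ### Linear differential equations with bounded operators. -/

section LinearODE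

/-- Inhomogeneous linear equations `v' = L v + p` with a bounded operator are solvable. -/
theorem exists_hasDerivAt_clm_add {X : Type*} [NormedAddCommGroup X] [NormedSpace ℝ X]
    [CompleteSpace X] (L : X →L[ℝ] X) {p : ℝ → X} (hp : Continuous p) :
    ∃ v : ℝ → X, v 0 = 0 ∧ ∀ t, HasDerivAt v (L (v t) + p t) t := by
  have hexp : ∀ t : ℝ, HasDerivAt (fun u : ℝ => NormedSpace.exp (u • L))
      (L * NormedSpace.exp (t • L)) t := fun t => hasDerivAt_exp_smul_const' L t
  have hcont : Continuous fun t : ℝ => NormedSpace.exp (t • L) :=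
    continuous_iff_continuousAt.2 fun t => (hexp t).continuousAt
  have hq : Continuous fun s : ℝ => NormedSpace.exp ((-s) • L) (p s) :=
    (hcont.comp continuous_neg).clm_apply hp
  -- Duhamel's formula.
  refine ⟨fun t => NormedSpace.exp (t • L) (∫ s in (0 : ℝ)..t, NormedSpace.exp ((-s) • L) (p s)),
    by simp, fun t => ?_⟩
  have h2 : HasDerivAt (fun t => ∫ s in (0 : ℝ)..t, NormedSpace.exp ((-s) • L) (p s))
      (NormedSpace.exp ((-t) • L) (p t)) t := (hq.integral_hasStrictDerivAt 0 t).hasDerivAt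
  convert (hexp t).clm_apply h2 using 1
  have h3 : NormedSpace.exp (t • L) * NormedSpace.exp ((-t) • L) = 1 := by
    rw [neg_smul]
    let : NormedAlgebra ℚ (X →L[ℝ] X) := NormedAlgebra.restrictScalars ℚ ℝ (X →L[ℝ] X)
    rw [← NormedSpace.exp_add_of_commute ((Commute.refl (t • L)).neg_right), add_neg_cancel,
      NormedSpace.exp_zero]
  have h4 := congrArg (fun N : X →L[ℝ] X => N (p t)) h3
  simp only [mul_apply_eq_comp, one_apply_eq_self] at h4
  rw [h4]
  rfl

end LinearODE

/-! ### The energy estimate for C¹ functions. -/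

section Parabolic

variable {V H : Type*} [NormedAddCommGroup V] [InnerProductSpace ℝ V]
  [NormedAddCommGroup H] [InnerProductSpace ℝ H]

/-- The form `(u, v) ↦ ⟪j u, j v⟫` of a map into an inner product space. -/
def massForm (j : V →L[ℝ] H) : V →L[ℝ] StrongDual ℝ V :=
  (innerSL ℝ : H →L[ℝ] H →L[ℝ] ℝ).bilinearComp j j

@[simp]
theorem massForm_apply (j : V →L[ℝ] H) (u v : V) : massForm j u v = ⟪j u, j v⟫_ℝ := rfl

/-- The energy estimate for continuously differentiable solutions of
`⟪j w', j v⟫ + ε ⟪w', v⟫ + B(w, v) = R(v)`. -/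
theorem energy_estimate (j : V →L[ℝ] H) (B : V →L[ℝ] StrongDual ℝ V) {ε l κ : ℝ} (hε : 0 ≤ ε)
    (hl : 0 ≤ l) {q : V → ℝ} (hq : Continuous q)
    (hqB : ∀ (v : V) (S : StrongDual ℝ V),
      2 * S v - 2 * B v v ≤ 2 * l * ‖j v‖ ^ 2 - q v + κ * ‖S‖ ^ 2)
    {w w' : ℝ → V} {R : ℝ → StrongDual ℝ V} (hw : ∀ t, HasDerivAt w (w' t) t)
    (hR : Continuous R)
    (heq : ∀ t, massForm j (w' t) + ε • massForm (.id ℝ V) (w' t) + B (w t) = R t) {t : ℝ} (ht : 0 ≤ t) :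
    Real.exp (-2 * l * t) * (‖j (w t)‖ ^ 2 + ε * ‖w t‖ ^ 2)
      + ∫ s in (0 : ℝ)..t, Real.exp (-2 * l * s) * q (w s)
    ≤ ‖j (w 0)‖ ^ 2 + ε * ‖w 0‖ ^ 2
      + κ * ∫ s in (0 : ℝ)..t, Real.exp (-2 * l * s) * ‖R s‖ ^ 2 := by
  have hwc : Continuous w := continuous_iff_continuousAt.2 fun t => (hw t).continuousAt
  have hE : Continuous fun s : ℝ => Real.exp (-2 * l * s) := by fun_prop
  have hi1 : Continuous fun s => Real.exp (-2 * l * s) * q (w s) := hE.mul (hq.comp hwc)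
  have hi2 : Continuous fun s => Real.exp (-2 * l * s) * ‖R s‖ ^ 2 := hE.mul (hR.norm.pow 2)
  -- The weighted energy balance. `hqB` makes its derivative nonpositive: the weight absorbs the
  -- term 2l‖j w‖², and the leftover -2lε‖w‖² has the right sign.
  let Φ : ℝ → ℝ := fun t => Real.exp (-2 * l * t) * (‖j (w t)‖ ^ 2 + ε * ‖w t‖ ^ 2)
      + (∫ s in (0 : ℝ)..t, Real.exp (-2 * l * s) * q (w s))
      - κ * ∫ s in (0 : ℝ)..t, Real.exp (-2 * l * s) * ‖R s‖ ^ 2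
  have hΦ : ∀ t, HasDerivAt Φ (Real.exp (-2 * l * t) * (-2 * l)
        * (‖j (w t)‖ ^ 2 + ε * ‖w t‖ ^ 2)
      + Real.exp (-2 * l * t) * (2 * ⟪j (w t), j (w' t)⟫_ℝ + ε * (2 * ⟪w t, w' t⟫_ℝ))
      + Real.exp (-2 * l * t) * q (w t) - κ * (Real.exp (-2 * l * t) * ‖R t‖ ^ 2)) t := by
    intro t
    have h1 : HasDerivAt (fun t : ℝ => Real.exp (-2 * l * t))
        (Real.exp (-2 * l * t) * (-2 * l)) t := by
      simpa using ((hasDerivAt_id t).const_mul (-2 * l)).exp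
    have h2 : HasDerivAt (fun t => ‖j (w t)‖ ^ 2) (2 * ⟪j (w t), j (w' t)⟫_ℝ) t :=
      (j.hasFDerivAt.comp_hasDerivAt t (hw t)).norm_sq
    have h3 : HasDerivAt (fun t => ‖w t‖ ^ 2) (2 * ⟪w t, w' t⟫_ℝ) t := (hw t).norm_sq
    exact ((h1.mul (h2.add (h3.const_mul ε))).add
      (hi1.integral_hasStrictDerivAt 0 t).hasDerivAt).sub
      ((hi2.integral_hasStrictDerivAt 0 t).hasDerivAt.const_mul κ)
  have hanti : Antitone Φ := by
    refine antitone_of_deriv_nonpos (fun t => (hΦ t).differentiableAt) fun t => ?_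
    rw [(hΦ t).deriv]
    have h4 := congrArg (fun N : StrongDual ℝ V => N (w t)) (heq t)
    simp only [add_apply, smul_apply, massForm_apply, ContinuousLinearMap.id_apply,
      smul_eq_mul] at h4
    rw [real_inner_comm, real_inner_comm (w t)] at h4
    have h5 := hqB (w t) (R t)
    have h6 : 0 ≤ l * (ε * ‖w t‖ ^ 2) := by positivity
    have h7 := Real.exp_pos (-2 * l * t)
    have h8 : -2 * l * (‖j (w t)‖ ^ 2 + ε * ‖w t‖ ^ 2)
      + (2 * ⟪j (w t), j (w' t)⟫_ℝ + ε * (2 * ⟪w t, w' t⟫_ℝ)) + q (w t) - κ * ‖R t‖ ^ 2 ≤ 0 := by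
      nlinarith
    nlinarith
  have := hanti ht
  simp only [Φ, mul_zero, Real.exp_zero, one_mul, intervalIntegral.integral_same] at this
  linarith

end Parabolic

end

noncomputable section

/-! ### The regularised equation as an ODE in V. -/

section Regularised

variable {V H : Type*} [NormedAddCommGroup V] [InnerProductSpace ℝ V]
  [NormedAddCommGroup H] [InnerProductSpace ℝ H]

/-- For a continuously differentiable right-hand side that is compatible with the initial value,
the regularised equation has a twice differentiable solution, whose derivative solves the
differentiated equation with initial value zero. -/
theorem exists_regularised_solution [CompleteSpace V] (j : V →L[ℝ] H)
    (B : V →L[ℝ] StrongDual ℝ V) {ε : ℝ} (hε : 0 < ε) {P F : ℝ → StrongDual ℝ V}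
    (hP : Continuous P) (hF : ∀ t, HasDerivAt F (P t) t) {u₀ : V} (h0 : F 0 = B u₀) :
    ∃ w w' w'' : ℝ → V, w 0 = u₀ ∧ w' 0 = 0 ∧ (∀ t, HasDerivAt w (w' t) t) ∧
      (∀ t, HasDerivAt w' (w'' t) t) ∧
      (∀ t, massForm j (w' t) + ε • massForm (.id ℝ V) (w' t) + B (w t) = F t) ∧
      ∀ t, massForm j (w'' t) + ε • massForm (.id ℝ V) (w'' t) + B (w' t) = P t := by
  let N : V →L[ℝ] StrongDual ℝ V := massForm j + ε • massForm (.id ℝ V)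
  have hNapp : ∀ v, N v = massForm j v + ε • massForm (.id ℝ V) v := fun v => rfl
  have hN : IsCoercive N := by
    refine ⟨ε, hε, fun u => ?_⟩
    simp only [hNapp, add_apply, smul_apply, massForm_apply, ContinuousLinearMap.id_apply, smul_eq_mul,
      real_inner_self_eq_norm_sq]
    nlinarith [sq_nonneg ‖j u‖]
  let e : V ≃L[ℝ] V := hN.continuousLinearEquivOfBilin
  let b : V →L[ℝ] V := InnerProductSpace.continuousLinearMapOfBilin B
  let ι : StrongDual ℝ V → V := (InnerProductSpace.toDual ℝ V).symm
  have hι : Continuous ι := (InnerProductSpace.toDual ℝ V).symm.continuous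
  -- The differentiated equation is solved first, for v = w'. The ε-term makes N coercive, so
  -- Lax–Milgram inverts it and N v' + B v = P becomes an ODE with a bounded operator.
  obtain ⟨v, hv0, hv⟩ := exists_hasDerivAt_clm_add (-((e.symm : V →L[ℝ] V) ∘L b))
    (p := fun t => e.symm (ι (P t))) (e.symm.continuous.comp (hι.comp hP))
  have hNv : ∀ t, N (-((e.symm : V →L[ℝ] V) ∘L b) (v t) + e.symm (ι (P t))) + B (v t) = P t := by
    intro t
    ext u
    have h1 : ∀ x, N x u = ⟪e x, u⟫_ℝ :=
      fun x => (hN.continuousLinearEquivOfBilin_apply x u).symm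
    have h2 : -((e.symm : V →L[ℝ] V) ∘L b) (v t) + e.symm (ι (P t))
        = e.symm (ι (P t) - b (v t)) := by
      simp only [ContinuousLinearMap.comp_apply, map_sub, ContinuousLinearEquiv.coe_coe]
      abel
    rw [add_apply, h2, h1, ContinuousLinearEquiv.apply_symm_apply, inner_sub_left,
      InnerProductSpace.toDual_symm_apply, InnerProductSpace.continuousLinearMapOfBilin_apply]
    ring
  have hvc : Continuous v := continuous_iff_continuousAt.2 fun t => (hv t).continuousAt
  have hw : ∀ t, HasDerivAt (fun t => u₀ + ∫ s in (0 : ℝ)..t, v s) (v t) t := fun t =>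
    (hvc.integral_hasStrictDerivAt 0 t).hasDerivAt.const_add u₀
  refine ⟨fun t => u₀ + ∫ s in (0 : ℝ)..t, v s, v,
    fun t => -((e.symm : V →L[ℝ] V) ∘L b) (v t) + e.symm (ι (P t)), by simp, hv0, hw, hv, ?_, hNv⟩
  -- The residual of the original equation is constant in time, and it is zero at t = 0 because v 0
  -- = 0 and F 0 = B u₀.
  have hd : ∀ t, HasDerivAt (fun t => N (v t) + B (u₀ + ∫ s in (0 : ℝ)..t, v s) - F t) 0 t := by
    intro t
    exact (((N.hasFDerivAt.comp_hasDerivAt t (hv t)).add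
      (B.hasFDerivAt.comp_hasDerivAt t (hw t))).sub (hF t)).congr_deriv
      (sub_eq_zero.2 (hNv t))
  have hconst := is_const_of_deriv_eq_zero (fun t => (hd t).differentiableAt)
    (fun t => (hd t).deriv)
  intro t
  have h3 := hconst t 0
  simp only [hv0, map_zero, intervalIntegral.integral_same, add_zero, h0, zero_add, sub_self]
    at h3
  exact sub_eq_zero.1 h3

end Regularised

end

noncomputable section

/-! ### Square integrable functions and integrals on intervals. -/

section SquareIntegrable

variable {X E : Type*} [MeasurableSpace X] {μ : Measure X} [NormedAddCommGroup E]

theorem eLpNorm_two_eq_ofReal_sqrt {h : X → E} (hh : MemLp h 2 μ) :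
    eLpNorm h 2 μ = ENNReal.ofReal (Real.sqrt (∫ x, ‖h x‖ ^ 2 ∂μ)) := by
  rw [hh.eLpNorm_eq_integral_rpow_norm (by norm_num) (by norm_num)]
  simp [Real.sqrt_eq_rpow]

theorem eLpNorm_two_le_of_integral_sq_le {h : X → E} (hh : MemLp h 2 μ) {δ : ℝ} (hδ : 0 ≤ δ)
    (hle : ∫ x, ‖h x‖ ^ 2 ∂μ ≤ δ ^ 2) : eLpNorm h 2 μ ≤ ENNReal.ofReal δ := by
  rw [eLpNorm_two_eq_ofReal_sqrt hh]
  exact ENNReal.ofReal_le_ofReal ((Real.sqrt_le_left hδ).2 hle)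

theorem integral_sq_le_of_eLpNorm_two_le {h : X → E} (hh : MemLp h 2 μ) {δ : ℝ} (hδ : 0 ≤ δ)
    (hle : eLpNorm h 2 μ ≤ ENNReal.ofReal δ) : ∫ x, ‖h x‖ ^ 2 ∂μ ≤ δ ^ 2 := by
  rw [eLpNorm_two_eq_ofReal_sqrt hh, ENNReal.ofReal_le_ofReal_iff hδ] at hle
  exact (Real.sqrt_le_left hδ).1 hle

theorem Continuous.memLp_two_Ioo {h : ℝ → E} (hh : Continuous h) (a b : ℝ) :
    MemLp h 2 (volume.restrict (Ioo a b)) := by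
  have : IsFiniteMeasure (volume.restrict (Ioo a b)) := inferInstance
  obtain ⟨C, hC⟩ := (isCompact_Icc (a := a) (b := b)).exists_bound_of_continuousOn hh.continuousOn
  refine MemLp.of_bound hh.aestronglyMeasurable C ?_
  exact (ae_restrict_mem measurableSet_Ioo).mono fun x hx => hC x (Ioo_subset_Icc_self hx)

theorem setIntegral_Ioo_eq_intervalIntegral {F : Type*} [NormedAddCommGroup F] [NormedSpace ℝ F]
    (h : ℝ → F) {a b : ℝ} (hab : a ≤ b) :
    ∫ t in Ioo a b, h t = ∫ t in a..b, h t := by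
  rw [intervalIntegral.integral_of_le hab, integral_Ioc_eq_integral_Ioo]

end SquareIntegrable

/-! ### Approximate solutions with values in V. -/

section Approximation

variable {V H : Type*} [NormedAddCommGroup V] [InnerProductSpace ℝ V]
  [NormedAddCommGroup H] [InnerProductSpace ℝ H]

theorem norm_massForm_id_le (v : V) : ‖massForm (.id ℝ V) v‖ ≤ ‖v‖ :=
  ContinuousLinearMap.opNorm_le_bound _ (norm_nonneg v) fun u => by
    simpa using norm_inner_le_norm (𝕜 := ℝ) v u

/-- The energy estimate for weakly coercive forms. -/
theorem energy_estimate_of_weaklyCoercive (j : V →L[ℝ] H) (B : V →L[ℝ] StrongDual ℝ V)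
    {c l ε T : ℝ} (hc : 0 < c) (hl : 0 ≤ l) (hε : 0 ≤ ε)
    (hB : ∀ v, c * ‖v‖ ^ 2 ≤ B v v + l * ‖j v‖ ^ 2)
    {w w' : ℝ → V} {R : ℝ → StrongDual ℝ V} (hw : ∀ t, HasDerivAt w (w' t) t)
    (hR : Continuous R)
    (heq : ∀ t, massForm j (w' t) + ε • massForm (.id ℝ V) (w' t) + B (w t) = R t)
    (hT : 0 ≤ T) :
    (∀ t ∈ Icc 0 T, ‖j (w t)‖ ^ 2 ≤ Real.exp (2 * l * T) * (‖j (w 0)‖ ^ 2 + ε * ‖w 0‖ ^ 2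
      + c⁻¹ * ∫ s in Ioo 0 T, ‖R s‖ ^ 2)) ∧
    c * ∫ s in Ioo 0 T, ‖w s‖ ^ 2 ≤ Real.exp (2 * l * T) * (‖j (w 0)‖ ^ 2 + ε * ‖w 0‖ ^ 2
      + c⁻¹ * ∫ s in Ioo 0 T, ‖R s‖ ^ 2) := by
  have hwc : Continuous w := continuous_iff_continuousAt.2 fun t => (hw t).continuousAt
  have hE : Continuous fun s : ℝ => Real.exp (-2 * l * s) := by fun_prop
  have hR2 : Continuous fun s => ‖R s‖ ^ 2 := hR.norm.pow 2
  have hw2 : Continuous fun s => ‖w s‖ ^ 2 := hwc.norm.pow 2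
  have key : ∀ t ∈ Icc 0 T, Real.exp (-2 * l * T) * ‖j (w t)‖ ^ 2
      + Real.exp (-2 * l * T) * (c * ∫ s in (0 : ℝ)..t, ‖w s‖ ^ 2)
      ≤ ‖j (w 0)‖ ^ 2 + ε * ‖w 0‖ ^ 2 + c⁻¹ * ∫ s in Ioo 0 T, ‖R s‖ ^ 2 := by
    rintro t ⟨h0, h1⟩
    -- Young's inequality spends half of the 2c‖v‖² that weak coercivity supplies; the other half
    -- stays on the left.
    have hqB : ∀ (v : V) (S : StrongDual ℝ V), 2 * S v - 2 * B v v
        ≤ 2 * l * ‖j v‖ ^ 2 - c * ‖v‖ ^ 2 + c⁻¹ * ‖S‖ ^ 2 := by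
      intro v S
      have h2 : S v ≤ ‖S‖ * ‖v‖ := (le_abs_self _).trans (S.le_opNorm v)
      have h3 : 2 * (‖S‖ * ‖v‖) ≤ c * ‖v‖ ^ 2 + c⁻¹ * ‖S‖ ^ 2 := by
        have h4 : 0 ≤ c * (‖v‖ - c⁻¹ * ‖S‖) ^ 2 := by positivity
        have h5 : c * (‖v‖ - c⁻¹ * ‖S‖) ^ 2
          = c * ‖v‖ ^ 2 + c⁻¹ * ‖S‖ ^ 2 - 2 * (‖S‖ * ‖v‖) := by field_simp; ring
        linarith
      linarith [hB v]
    have hest := energy_estimate j B hε hl (q := fun v => c * ‖v‖ ^ 2) (by fun_prop) hqB hw hR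
      heq h0
    -- The weight lies between exp(-2lT) and 1 on [0,T]: the lower bound serves the left-hand side,
    -- the upper bound the data.
    have hexp : ∀ s ∈ Icc 0 t, Real.exp (-2 * l * T) ≤ Real.exp (-2 * l * s) := fun s hs =>
      Real.exp_le_exp.2 (by nlinarith [hs.2])
    have e1 : Real.exp (-2 * l * T) * ‖j (w t)‖ ^ 2
        ≤ Real.exp (-2 * l * t) * (‖j (w t)‖ ^ 2 + ε * ‖w t‖ ^ 2) :=
      mul_le_mul (hexp t ⟨h0, le_rfl⟩) (le_add_of_nonneg_right (by positivity)) (by positivity)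
        (by positivity)
    have e2 : Real.exp (-2 * l * T) * (c * ∫ s in (0 : ℝ)..t, ‖w s‖ ^ 2)
        ≤ ∫ s in (0 : ℝ)..t, Real.exp (-2 * l * s) * (c * ‖w s‖ ^ 2) := by
      rw [← intervalIntegral.integral_const_mul, ← intervalIntegral.integral_const_mul]
      refine intervalIntegral.integral_mono_on h0 (Continuous.intervalIntegrable (by fun_prop) _ _)
        (Continuous.intervalIntegrable (by fun_prop) _ _) fun s hs => ?_
      exact mul_le_mul_of_nonneg_right (hexp s hs) (by positivity)
    have e3 : ∫ s in (0 : ℝ)..t, Real.exp (-2 * l * s) * ‖R s‖ ^ 2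
        ≤ ∫ s in Ioo 0 T, ‖R s‖ ^ 2 := by
      rw [setIntegral_Ioo_eq_intervalIntegral _ (h0.trans h1)]
      calc _ ≤ ∫ s in (0 : ℝ)..t, ‖R s‖ ^ 2 := by
            refine intervalIntegral.integral_mono_on h0
              (Continuous.intervalIntegrable (by fun_prop) _ _)
              (Continuous.intervalIntegrable (by fun_prop) _ _) fun s hs => ?_
            refine mul_le_of_le_one_left (by positivity) (Real.exp_le_one_iff.2 ?_)
            nlinarith [hs.1]
        _ ≤ _ := intervalIntegral.integral_mono_interval le_rfl h0 h1
            (Eventually.of_forall fun s => by positivity) (hR2.intervalIntegrable _ _)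
    have e4 := mul_le_mul_of_nonneg_left e3 (inv_pos.2 hc).le
    linarith
  have hfac : Real.exp (2 * l * T) * Real.exp (-2 * l * T) = 1 := by
    rw [← Real.exp_add]; simp
  have hpos := Real.exp_pos (2 * l * T)
  have hneg := Real.exp_pos (-2 * l * T)
  have hint : ∀ t, 0 ≤ t → 0 ≤ ∫ s in (0 : ℝ)..t, ‖w s‖ ^ 2 := fun t ht =>
    intervalIntegral.integral_nonneg ht fun s _ => by positivity
  constructor
  · intro t ht
    have h1 := key t ht
    have h2 : 0 ≤ Real.exp (-2 * l * T) * (c * ∫ s in (0 : ℝ)..t, ‖w s‖ ^ 2) :=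
      mul_nonneg hneg.le (mul_nonneg hc.le (hint t ht.1))
    have h3 := mul_le_mul_of_nonneg_left (h1.trans' (le_add_of_nonneg_right h2)) hpos.le
    rwa [← mul_assoc, hfac, one_mul] at h3
  · have h1 := key T ⟨hT, le_rfl⟩
    rw [setIntegral_Ioo_eq_intervalIntegral (fun s => ‖w s‖ ^ 2) hT]
    have h2 : 0 ≤ Real.exp (-2 * l * T) * ‖j (w T)‖ ^ 2 := by positivity
    have h3 := mul_le_mul_of_nonneg_left (h1.trans' (le_add_of_nonneg_left h2)) hpos.le
    rwa [← mul_assoc, hfac, one_mul] at h3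

/-- Every right-hand side and initial value of the parabolic problem can be approximated by those
of a continuously differentiable function with values in `V`. -/
theorem exists_approximate_solution [CompleteSpace V] (j : V →L[ℝ] H)
    (B : V →L[ℝ] StrongDual ℝ V) {c l T : ℝ} (hc : 0 < c) (hl : 0 ≤ l)
    (hB : ∀ v, c * ‖v‖ ^ 2 ≤ B v v + l * ‖j v‖ ^ 2) (hT : 0 ≤ T) {f : ℝ → StrongDual ℝ V}
    (hf : MemLp f 2 (volume.restrict (Ioo 0 T))) {u₀ : H} (hu₀ : u₀ ∈ closure (range j))
    {δ : ℝ} (hδ : 0 < δ) :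
    ∃ w w' : ℝ → V, Continuous w' ∧ (∀ t, HasDerivAt w (w' t) t) ∧ ‖j (w 0) - u₀‖ ≤ δ ∧
      eLpNorm (fun t => massForm j (w' t) + B (w t) - f t) 2 (volume.restrict (Ioo 0 T))
        ≤ ENNReal.ofReal δ := by
  obtain ⟨_, ⟨v₀, rfl⟩, hv₀⟩ := Metric.mem_closure_iff.1 hu₀ δ hδ
  obtain ⟨g, -, hg, hfg⟩ := hf.exist_eLpNorm_sub_le (by norm_num) (by norm_num)
    (show 0 < δ / 3 by positivity)
  -- Adding exp(-kt) a to g makes the data compatible, F 0 = B v₀, so that w' starts from zero.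
  let a : StrongDual ℝ V := B v₀ - g 0
  -- The squared L² norm of exp(-kt) a is at most ‖a‖² / (2k) ≤ (δ/3)². The + 1 keeps k positive if
  -- a = 0.
  let k : ℝ := (‖a‖ ^ 2 + 1) / (δ / 3) ^ 2
  have hk : 0 < k := by positivity
  have hgd : ∀ t, HasDerivAt g (deriv g t) t := fun t =>
    (hg.differentiable (by simp) t).hasDerivAt
  have hgc : Continuous (deriv g) := hg.continuous_deriv (by simp)
  let F : ℝ → StrongDual ℝ V := fun t => g t + Real.exp (-k * t) • a
  let P : ℝ → StrongDual ℝ V := fun t => deriv g t + (Real.exp (-k * t) * (-k)) • a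
  have hF : ∀ t, HasDerivAt F (P t) t := by
    intro t
    have h1 : HasDerivAt (fun t : ℝ => Real.exp (-k * t)) (Real.exp (-k * t) * (-k)) t := by
      simpa using ((hasDerivAt_id t).const_mul (-k)).exp
    exact (hgd t).add (h1.smul_const a)
  have hP : Continuous P := by fun_prop
  have hF0 : F 0 = B v₀ := by simp [F, a]
  -- The energy estimate of the differentiated equation bounds ∫ ‖w'‖² by K. It does not involve ε,
  -- which can therefore be chosen afterwards.
  let K : ℝ := Real.exp (2 * l * T) * (c⁻¹ * ∫ s in Ioo 0 T, ‖P s‖ ^ 2) / c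
  have hK : 0 ≤ K := by positivity
  let ε : ℝ := (δ / 3) / (K + 1)
  have hε : 0 < ε := by positivity
  obtain ⟨w, w', w'', hw0, hw0', hw, hw', heq, heq'⟩ := exists_regularised_solution j B hε hP hF hF0
  have hwc' : Continuous w' := continuous_iff_continuousAt.2 fun t => (hw' t).continuousAt
  refine ⟨w, w', hwc', hw, ?_, ?_⟩
  · rw [hw0, ← dist_eq_norm, dist_comm]; exact hv₀.le
  -- The residual error has three parts, each of norm at most δ/3: the compatibility correction, the
  -- ε-term and g - f.
  have hsplit : (fun t => massForm j (w' t) + B (w t) - f t)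
      = (fun t => Real.exp (-k * t) • a) + (fun t => -(ε • massForm (.id ℝ V) (w' t)))
        + (g - f) := by
    funext t
    simp only [Pi.add_apply, Pi.sub_apply]
    have h1 : massForm j (w' t) + B (w t) = F t - ε • massForm (.id ℝ V) (w' t) := by
      rw [← heq t]; abel
    rw [h1]
    simp only [F]
    abel
  have hc1 : Continuous fun t : ℝ => Real.exp (-k * t) • a := by fun_prop
  have hc2 : Continuous fun t => -(ε • massForm (.id ℝ V) (w' t)) := by fun_prop
  have hb1 : eLpNorm (fun t => Real.exp (-k * t) • a) 2 (volume.restrict (Ioo 0 T))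
      ≤ ENNReal.ofReal (δ / 3) := by
    refine eLpNorm_two_le_of_integral_sq_le (hc1.memLp_two_Ioo 0 T) (by positivity) ?_
    have h1 : ∀ t : ℝ, HasDerivAt (fun t => -(Real.exp (-k * t)) ^ 2 * (‖a‖ ^ 2 / (2 * k)))
        (‖Real.exp (-k * t) • a‖ ^ 2) t := by
      intro t
      have h2 : HasDerivAt (fun t : ℝ => Real.exp (-k * t)) (Real.exp (-k * t) * (-k)) t := by
        simpa using ((hasDerivAt_id t).const_mul (-k)).exp
      refine ((h2.pow 2).neg.mul_const (‖a‖ ^ 2 / (2 * k))).congr_deriv ?_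
      rw [norm_smul, Real.norm_eq_abs, Real.abs_exp]
      field_simp
      norm_num
      ring
    rw [setIntegral_Ioo_eq_intervalIntegral _ hT,
      intervalIntegral.integral_eq_sub_of_hasDerivAt (fun t _ => h1 t)
        ((hc1.norm.pow 2).intervalIntegrable _ _)]
    simp only [mul_zero, Real.exp_zero]
    have h3 : ‖a‖ ^ 2 / (2 * k) ≤ (δ / 3) ^ 2 := by
      rw [div_le_iff₀ (by positivity)]
      have : (δ / 3) ^ 2 * k = ‖a‖ ^ 2 + 1 := by
        simp only [k]; field_simp
      nlinarith [sq_nonneg ‖a‖]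
    have h4 : 0 ≤ (Real.exp (-k * T)) ^ 2 * (‖a‖ ^ 2 / (2 * k)) := by positivity
    linarith
  have hb2 : eLpNorm (fun t => -(ε • massForm (.id ℝ V) (w' t))) 2 (volume.restrict (Ioo 0 T))
      ≤ ENNReal.ofReal (δ / 3) := by
    refine eLpNorm_two_le_of_integral_sq_le (hc2.memLp_two_Ioo 0 T) (by positivity) ?_
    have h1 := (energy_estimate_of_weaklyCoercive j B hc hl hε.le hB hw' hP heq' hT).2
    rw [hw0', map_zero, norm_zero, norm_zero] at h1
    have h2 : ∫ s in Ioo 0 T, ‖w' s‖ ^ 2 ≤ K := by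
      rw [le_div_iff₀ hc]
      linarith
    have h3 : ∫ t in Ioo 0 T, ‖-(ε • massForm (.id ℝ V) (w' t))‖ ^ 2
        ≤ ε ^ 2 * ∫ s in Ioo 0 T, ‖w' s‖ ^ 2 := by
      rw [← integral_const_mul]
      refine integral_mono_of_nonneg (Eventually.of_forall fun t => by positivity)
        ((hwc'.memLp_two_Ioo 0 T).integrable_norm_pow (by norm_num) |>.const_mul _)
        (Eventually.of_forall fun t => ?_)
      simp only [norm_neg, norm_smul, Real.norm_eq_abs, abs_of_pos hε, mul_pow]
      gcongr
      exact norm_massForm_id_le _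
    have h4 : ε ^ 2 * K ≤ (δ / 3) ^ 2 := by
      simp only [ε, div_pow]
      rw [div_mul_eq_mul_div, div_le_iff₀ (by positivity)]
      have : 0 ≤ (δ / 3) ^ 2 := by positivity
      rw [div_pow] at this
      nlinarith [mul_nonneg this (sq_nonneg K), mul_nonneg this hK]
    nlinarith [sq_nonneg ε]
  have hb3 : eLpNorm (g - f) 2 (volume.restrict (Ioo 0 T)) ≤ ENNReal.ofReal (δ / 3) := by
    rwa [eLpNorm_sub_comm]
  rw [hsplit]
  have hm1 := hc1.aestronglyMeasurable (μ := volume.restrict (Ioo 0 T))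
  have hm2 := hc2.aestronglyMeasurable (μ := volume.restrict (Ioo 0 T))
  have hm3 := (hg.continuous.aestronglyMeasurable (μ := volume.restrict (Ioo 0 T))).sub
    hf.aestronglyMeasurable
  calc _ ≤ _ := (eLpNorm_add_le (hm1.add hm2) hm3 (by norm_num)).trans
          (add_le_add_left (eLpNorm_add_le hm1 hm2 (by norm_num)) _)
    _ ≤ ENNReal.ofReal (δ / 3) + ENNReal.ofReal (δ / 3) + ENNReal.ofReal (δ / 3) := by gcongr
    _ = ENNReal.ofReal δ := by
      rw [← ENNReal.ofReal_add (by positivity) (by positivity),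
        ← ENNReal.ofReal_add (by positivity) (by positivity)]
      congr 1; ring

end Approximation

end

noncomputable section

/-! ### Limits of integrals under L² convergence. -/

section Convergence

variable {X E : Type*} [MeasurableSpace X] {μ : Measure X} [NormedAddCommGroup E]

/-- By Hölder's inequality the products converge in L¹. This passes the time integrals of the weak
formulation to the limit. -/
theorem tendsto_integral_clm_mul [NormedSpace ℝ E] {h : ℕ → X → E} {h₀ : X → E}
    (hh : ∀ k, MemLp (h k) 2 μ) (hh₀ : MemLp h₀ 2 μ)
    (hlim : Tendsto (fun k => eLpNorm (h k - h₀) 2 μ) atTop (𝓝 0)) (Λ : StrongDual ℝ E)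
    {ψ : X → ℝ} (hψ : MemLp ψ 2 μ) :
    Tendsto (fun k => ∫ t, Λ (h k t) * ψ t ∂μ) atTop (𝓝 (∫ t, Λ (h₀ t) * ψ t ∂μ)) := by
  have hΛ : ∀ g : X → E, MemLp g 2 μ → MemLp (fun t => Λ (g t)) 2 μ := fun g hg =>
    Λ.comp_memLp' hg
  refine tendsto_integral_of_L1' _ ((hΛ _ hh₀).integrable_mul hψ).aestronglyMeasurable
    (Eventually.of_forall fun k => (hΛ _ (hh k)).integrable_mul hψ) ?_
  have hbound : ∀ k, eLpNorm ((fun t => Λ (h k t) * ψ t) - fun t => Λ (h₀ t) * ψ t) 1 μ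
      ≤ ENNReal.ofReal ‖Λ‖ * eLpNorm (h k - h₀) 2 μ * eLpNorm ψ 2 μ := by
    intro k
    have h1 : ((fun t => Λ (h k t) * ψ t) - fun t => Λ (h₀ t) * ψ t)
        = (fun t => Λ ((h k - h₀) t)) • ψ := by
      funext t
      simp only [Pi.sub_apply, Pi.smul_apply', map_sub, smul_eq_mul]
      ring
    rw [h1]
    refine (eLpNorm_smul_le_mul_eLpNorm hψ.aestronglyMeasurable
      (hΛ _ ((hh k).sub hh₀)).aestronglyMeasurable (p := 2) (q := 2) (r := 1)).trans ?_
    gcongr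
    exact eLpNorm_le_mul_eLpNorm_of_ae_le_mul (Eventually.of_forall fun t => Λ.le_opNorm _) 2
  have hz : Tendsto (fun k => ENNReal.ofReal ‖Λ‖ * eLpNorm (h k - h₀) 2 μ * eLpNorm ψ 2 μ) atTop
      (𝓝 0) := by
    have := ENNReal.Tendsto.mul_const (ENNReal.Tendsto.const_mul hlim
      (Or.inr (ENNReal.ofReal_ne_top (r := ‖Λ‖)))) (Or.inr hψ.eLpNorm_ne_top)
    simpa using this
  exact tendsto_of_tendsto_of_tendsto_of_le_of_le tendsto_const_nhds hz (fun k => zero_le)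
    hbound

/-- Composition with `e` does not increase L² distances. It serves both integrals of the a priori
estimate, with `e` the energy seminorm and with `e` the dual norm. -/
theorem tendsto_integral_sq_of_lipschitz {h : ℕ → X → E} {h₀ : X → E}
    (hh : ∀ k, MemLp (h k) 2 μ) (hh₀ : MemLp h₀ 2 μ)
    (hlim : Tendsto (fun k => eLpNorm (h k - h₀) 2 μ) atTop (𝓝 0)) {e : E → ℝ}
    (he : LipschitzWith 1 e) (he0 : e 0 = 0) :
    Tendsto (fun k => ∫ t, e (h k t) ^ 2 ∂μ) atTop (𝓝 (∫ t, e (h₀ t) ^ 2 ∂μ)) := by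
  have hm : ∀ g : X → E, MemLp g 2 μ → MemLp (e ∘ g) 2 μ := fun g hg => he.comp_memLp he0 hg
  have hnorm : ∀ (g : X → E) (hg : MemLp g 2 μ),
      ∫ t, e (g t) ^ 2 ∂μ = ‖(hm g hg).toLp (e ∘ g)‖ ^ 2 := by
    intro g hg
    rw [Lp.norm_toLp, eLpNorm_two_eq_ofReal_sqrt (hm g hg),
      ENNReal.toReal_ofReal (Real.sqrt_nonneg _), Real.sq_sqrt (by positivity)]
    simp
  have hlim' : Tendsto (fun k => eLpNorm (e ∘ h k - e ∘ h₀) 2 μ) atTop (𝓝 0) := by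
    refine tendsto_of_tendsto_of_tendsto_of_le_of_le tendsto_const_nhds hlim
      (fun k => zero_le) fun k => eLpNorm_mono fun t => ?_
    simpa [dist_eq_norm] using he.dist_le_mul (h k t) (h₀ t)
  have := (Lp.tendsto_Lp_iff_tendsto_eLpNorm'' (fun k => e ∘ h k) (fun k => hm _ (hh k))
    (e ∘ h₀) (hm _ hh₀)).2 hlim'
  simpa only [hnorm _ hh₀, fun k => hnorm _ (hh k)] using (this.norm.pow 2)

end Convergence

/-! ### Passage to the limit in the approximate solutions. -/

section Limit

variable {V H : Type*} [NormedAddCommGroup V] [InnerProductSpace ℝ V]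
  [NormedAddCommGroup H] [InnerProductSpace ℝ H]

/-- Approximate solutions converge, in `L²(0,T;V)` and uniformly in time with values in `H`. -/
theorem exists_limit_of_approximate_solutions [CompleteSpace V] [CompleteSpace H] (j : V →L[ℝ] H)
    (B : V →L[ℝ] StrongDual ℝ V) {c l T : ℝ} (hc : 0 < c) (hl : 0 ≤ l)
    (hB : ∀ v, c * ‖v‖ ^ 2 ≤ B v v + l * ‖j v‖ ^ 2) (hT : 0 ≤ T) {f : ℝ → StrongDual ℝ V}
    (hf : MemLp f 2 (volume.restrict (Ioo 0 T))) {u₀ : H} (hu₀ : u₀ ∈ closure (range j)) :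
    ∃ (w w' : ℕ → ℝ → V) (u : ℝ → V) (U : ℝ → H), (∀ k, Continuous (w' k)) ∧
      (∀ k t, HasDerivAt (w k) (w' k t) t) ∧
      Tendsto (fun k => eLpNorm ((fun t => massForm j (w' k t) + B (w k t)) - f) 2
        (volume.restrict (Ioo 0 T))) atTop (𝓝 0) ∧
      MemLp u 2 (volume.restrict (Ioo 0 T)) ∧
      Tendsto (fun k => eLpNorm (w k - u) 2 (volume.restrict (Ioo 0 T))) atTop (𝓝 0) ∧
      ContinuousOn U (Icc 0 T) ∧ U 0 = u₀ ∧
      (∀ t ∈ Icc 0 T, Tendsto (fun k => j (w k t)) atTop (𝓝 (U t))) ∧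
      ∀ᵐ t ∂(volume.restrict (Ioo 0 T)), U t = j (u t) := by
  choose w w' hwc' hw hw0 hR using fun k : ℕ => exists_approximate_solution j B hc hl hB hT hf hu₀
    (show (0 : ℝ) < (1 / 2) ^ k by positivity)
  set μ := (volume : Measure ℝ).restrict (Ioo 0 T) with hμ
  have hwc : ∀ k, Continuous (w k) := fun k =>
    continuous_iff_continuousAt.2 fun t => (hw k t).continuousAt
  let R : ℕ → ℝ → StrongDual ℝ V := fun k t => massForm j (w' k t) + B (w k t)
  have hRc : ∀ k, Continuous (R k) := fun k =>
    ((massForm j).continuous.comp (hwc' k)).add (B.continuous.comp (hwc k))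
  have hpow : Tendsto (fun k : ℕ => ((1 : ℝ) / 2) ^ k) atTop (𝓝 0) :=
    tendsto_pow_atTop_nhds_zero_of_lt_one (by norm_num) (by norm_num)
  let K : ℝ := Real.exp (2 * l * T) * (1 + c⁻¹)
  have hK : 0 < K := by positivity
  -- By linearity the difference of two approximants solves the equation with ε = 0 and the
  -- difference of their residuals as data. Residuals and initial values each differ by at most 2
  -- (1/2)^N.
  have hdiff : ∀ n m N : ℕ, N ≤ n → N ≤ m →
      (∀ t ∈ Icc 0 T, ‖j (w n t - w m t)‖ ^ 2 ≤ K * (2 * (1 / 2) ^ N) ^ 2) ∧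
      c * ∫ s in Ioo 0 T, ‖w n s - w m s‖ ^ 2 ≤ K * (2 * (1 / 2) ^ N) ^ 2 := by
    intro n m N hn hm
    have hpn : ((1 : ℝ) / 2) ^ n ≤ (1 / 2) ^ N :=
      pow_le_pow_of_le_one (by norm_num) (by norm_num) hn
    have hpm : ((1 : ℝ) / 2) ^ m ≤ (1 / 2) ^ N :=
      pow_le_pow_of_le_one (by norm_num) (by norm_num) hm
    have hest := energy_estimate_of_weaklyCoercive j B (ε := 0) hc hl le_rfl hB
      (w := fun t => w n t - w m t) (w' := fun t => w' n t - w' m t) (R := fun t => R n t - R m t)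
      (fun t => (hw n t).sub (hw m t)) ((hRc n).sub (hRc m))
      (fun t => by simp only [map_sub, zero_smul, add_zero, R]; abel) hT
    have h1 : ‖j (w n 0 - w m 0)‖ ^ 2 ≤ (2 * (1 / 2) ^ N) ^ 2 := by
      have : ‖j (w n 0 - w m 0)‖ ≤ 2 * (1 / 2) ^ N := by
        calc _ = ‖(j (w n 0) - u₀) - (j (w m 0) - u₀)‖ := by rw [map_sub]; congr 1; abel
          _ ≤ _ := norm_sub_le _ _
          _ ≤ _ := by linarith [hw0 n, hw0 m]
      gcongr
    have h2 : ∫ s in Ioo 0 T, ‖R n s - R m s‖ ^ 2 ≤ (2 * (1 / 2) ^ N) ^ 2 := by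
      refine integral_sq_le_of_eLpNorm_two_le (((hRc n).sub (hRc m)).memLp_two_Ioo 0 T)
        (by positivity) ?_
      have h3 : R n - R m = (fun t => R n t - f t) - fun t => R m t - f t := by
        funext t; simp
      rw [h3]
      refine (eLpNorm_sub_le ((hRc n).aestronglyMeasurable.sub hf.aestronglyMeasurable)
        ((hRc m).aestronglyMeasurable.sub hf.aestronglyMeasurable) (by norm_num)).trans ?_
      refine (add_le_add (hR n) (hR m)).trans ?_
      rw [← ENNReal.ofReal_add (by positivity) (by positivity)]
      exact ENNReal.ofReal_le_ofReal (by linarith)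
    have h4 : Real.exp (2 * l * T) * (‖j (w n 0 - w m 0)‖ ^ 2 + 0 * ‖w n 0 - w m 0‖ ^ 2
        + c⁻¹ * ∫ s in Ioo 0 T, ‖R n s - R m s‖ ^ 2) ≤ K * (2 * (1 / 2) ^ N) ^ 2 := by
      have := mul_le_mul_of_nonneg_left h2 (inv_pos.2 hc).le
      simp only [K, mul_assoc]
      gcongr
      linarith
    exact ⟨fun t ht => (hest.1 t ht).trans h4, hest.2.trans h4⟩
  -- The + 1 provides the strict inequality that `Lp.cauchy_complete_eLpNorm` requires; the
  -- geometric factors are summable.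
  have hLp : ∀ N n m : ℕ, N ≤ n → N ≤ m →
      eLpNorm (w n - w m) 2 μ < ENNReal.ofReal (2 * Real.sqrt (K / c) + 1) * (1 / 2) ^ N := by
    intro N n m hn hm
    have h1 : eLpNorm (w n - w m) 2 μ ≤ ENNReal.ofReal (2 * Real.sqrt (K / c) * (1 / 2) ^ N) := by
      refine eLpNorm_two_le_of_integral_sq_le (((hwc n).sub (hwc m)).memLp_two_Ioo 0 T)
        (by positivity) ?_
      have h2 := (hdiff n m N hn hm).2
      rw [mul_comm, ← le_div_iff₀ hc] at h2
      refine h2.trans (le_of_eq ?_)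
      rw [mul_pow, mul_pow, mul_pow, Real.sq_sqrt (by positivity)]
      ring
    refine h1.trans_lt ?_
    have h3 : ENNReal.ofReal (2 * Real.sqrt (K / c) + 1) * (1 / 2) ^ N
        = ENNReal.ofReal ((2 * Real.sqrt (K / c) + 1) * (1 / 2) ^ N) := by
      rw [ENNReal.ofReal_mul (by positivity), ENNReal.ofReal_pow (by norm_num),
        ENNReal.ofReal_div_of_pos (by norm_num)]
      simp
    rw [h3]
    refine (ENNReal.ofReal_lt_ofReal_iff (by positivity)).2 ?_
    have : (0 : ℝ) < (1 / 2) ^ N := by positivity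
    linarith
  obtain ⟨u, hu, hwu⟩ := Lp.cauchy_complete_eLpNorm (p := 2) (by norm_num)
    (fun k => (hwc k).memLp_two_Ioo 0 T)
    (B := fun N => ENNReal.ofReal (2 * Real.sqrt (K / c) + 1) * (1 / 2) ^ N) (by
      rw [ENNReal.tsum_mul_left]
      refine ENNReal.mul_ne_top ENNReal.ofReal_ne_top ?_
      simp) hLp
  have hunif : UniformCauchySeqOn (fun k t => j (w k t)) atTop (Icc 0 T) := by
    rw [Metric.uniformCauchySeqOn_iff]
    intro η hη
    have hlim0 : Tendsto (fun N : ℕ => K * (2 * ((1 : ℝ) / 2) ^ N) ^ 2) atTop (𝓝 0) := by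
      simpa using ((hpow.const_mul 2).pow 2).const_mul K
    obtain ⟨N, hN⟩ := (hlim0.eventually_lt_const (show 0 < η ^ 2 by positivity)).exists
    refine ⟨N, fun m hm n hn t ht => ?_⟩
    rw [dist_eq_norm, ← map_sub]
    exact lt_of_pow_lt_pow_left₀ 2 hη.le (((hdiff m n N hm hn).1 t ht).trans_lt hN)
  have hex : ∀ t : ℝ, ∃ y : H, t ∈ Icc 0 T → Tendsto (fun k => j (w k t)) atTop (𝓝 y) := by
    intro t
    by_cases ht : t ∈ Icc 0 T
    · obtain ⟨y, hy⟩ := cauchySeq_tendsto_of_complete (hunif.cauchySeq ht)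
      exact ⟨y, fun _ => hy⟩
    · exact ⟨0, fun h => absurd h ht⟩
  choose U hU using hex
  have hUunif := hunif.tendstoUniformlyOn_of_tendsto hU
  refine ⟨w, w', u, U, hwc', hw, ?_, hu, hwu, ?_, ?_, hU, ?_⟩
  · refine tendsto_of_tendsto_of_tendsto_of_le_of_le tendsto_const_nhds ?_
      (fun k => zero_le) hR
    simpa using ENNReal.tendsto_ofReal hpow
  · exact hUunif.continuousOn
      (Frequently.of_forall fun k => (j.continuous.comp (hwc k)).continuousOn)
  · refine tendsto_nhds_unique (hU 0 ⟨le_rfl, hT⟩) ?_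
    rw [tendsto_iff_norm_sub_tendsto_zero]
    exact squeeze_zero (fun k => norm_nonneg _) hw0 hpow
  -- Along a subsequence that converges almost everywhere in V, the images under j tend both to U t
  -- and to j (u t).
  · obtain ⟨ns, hns, hae⟩ := (tendstoInMeasure_of_tendsto_eLpNorm (by norm_num)
      (fun k => (hwc k).aestronglyMeasurable) hu.aestronglyMeasurable hwu).exists_seq_tendsto_ae
    filter_upwards [hae, ae_restrict_mem measurableSet_Ioo] with t ht htT
    exact tendsto_nhds_unique ((hU t (Ioo_subset_Icc_self htT)).comp hns.tendsto_atTop)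
      ((j.continuous.tendsto _).comp ht)

end Limit

end

noncomputable section

/-! ### Existence and the a priori estimate in abstract form. -/

section Existence

variable {V H : Type*} [NormedAddCommGroup V] [InnerProductSpace ℝ V]
  [NormedAddCommGroup H] [InnerProductSpace ℝ H]

theorem ContDiff.deriv_smooth {φ : ℝ → ℝ} (hφ : ContDiff ℝ (⊤ : ℕ∞) φ) (t : ℝ) :
    HasDerivAt φ (deriv φ t) t :=
  (hφ.differentiable (by simp) t).hasDerivAt

theorem ContDiff.continuous_deriv_smooth {φ : ℝ → ℝ} (hφ : ContDiff ℝ (⊤ : ℕ∞) φ) :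
    Continuous (deriv φ) :=
  hφ.continuous_deriv (by simp)

/-- The weak formulation holds for continuously differentiable functions with values in `V`. -/
theorem weak_formulation_of_hasDerivAt (j : V →L[ℝ] H) (B : V →L[ℝ] StrongDual ℝ V) {T : ℝ}
    (hT : 0 ≤ T) {w w' : ℝ → V} (hwc' : Continuous w') (hw : ∀ t, HasDerivAt w (w' t) t) (v : V)
    {φ : ℝ → ℝ} (hφ : ContDiff ℝ (⊤ : ℕ∞) φ) (hφT : tsupport φ ⊆ Iio T) :
    -(∫ t in Ioo 0 T, ⟪j (w t), j v⟫_ℝ * deriv φ t) + ∫ t in Ioo 0 T, B (w t) v * φ t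
      = (∫ t in Ioo 0 T, (massForm j (w' t) + B (w t)) v * φ t) + ⟪j (w 0), j v⟫_ℝ * φ 0 := by
  have hwc : Continuous w := continuous_iff_continuousAt.2 fun t => (hw t).continuousAt
  have hφc := hφ.continuous
  have hφc' := hφ.continuous_deriv_smooth
  have hd : ∀ t, HasDerivAt (fun t => massForm j (w t) v * φ t)
      (massForm j (w' t) v * φ t + massForm j (w t) v * deriv φ t) t := by
    intro t
    have h1 : HasDerivAt (fun t => massForm j (w t)) (massForm j (w' t)) t :=
      (massForm j).hasFDerivAt.comp_hasDerivAt t (hw t)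
    have h2 : HasDerivAt (fun t => massForm j (w t) v) (massForm j (w' t) v) t := by
      simpa using h1.clm_apply (hasDerivAt_const t v)
    exact h2.mul (hφ.deriv_smooth t)
  have c1 : Continuous fun t => massForm j (w' t) v * φ t := by fun_prop
  have c2 : Continuous fun t => massForm j (w t) v * deriv φ t := by fun_prop
  have c3 : Continuous fun t => B (w t) v * φ t := by fun_prop
  have hftc := intervalIntegral.integral_eq_sub_of_hasDerivAt (a := 0) (b := T)
    (fun t _ => hd t) ((c1.add c2).intervalIntegrable _ _)
  rw [intervalIntegral.integral_add (c1.intervalIntegrable _ _) (c2.intervalIntegrable _ _)]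
    at hftc
  have hφ0 : φ T = 0 := image_eq_zero_of_notMem_tsupport fun h => lt_irrefl T (hφT h)
  simp only [setIntegral_Ioo_eq_intervalIntegral _ hT, add_apply, add_mul]
  rw [intervalIntegral.integral_add (c1.intervalIntegrable _ _) (c3.intervalIntegrable _ _)]
  simp only [hφ0, mul_zero, massForm_apply] at hftc ⊢
  linarith

/-- Existence of weak solutions of parabolic problems with a weakly coercive form, their
continuity in time, and the energy estimate. -/
theorem exists_weak_solution [CompleteSpace V] [CompleteSpace H] (j : V →L[ℝ] H)
    (B : V →L[ℝ] StrongDual ℝ V) {c l T : ℝ} (hc : 0 < c) (hl : 0 ≤ l)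
    (hB : ∀ v, c * ‖v‖ ^ 2 ≤ B v v + l * ‖j v‖ ^ 2) (hT : 0 ≤ T) {f : ℝ → StrongDual ℝ V}
    (hf : MemLp f 2 (volume.restrict (Ioo 0 T))) {u₀ : H} (hu₀ : u₀ ∈ closure (range j)) :
    ∃ u : ℝ → V, MemLp u 2 (volume.restrict (Ioo 0 T)) ∧
      (∀ v : V, ∀ φ : ℝ → ℝ, ContDiff ℝ (⊤ : ℕ∞) φ → HasCompactSupport φ → tsupport φ ⊆ Iio T →
        -(∫ t in Ioo 0 T, ⟪j (u t), j v⟫_ℝ * deriv φ t) + ∫ t in Ioo 0 T, B (u t) v * φ t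
          = (∫ t in Ioo 0 T, f t v * φ t) + ⟪u₀, j v⟫_ℝ * φ 0) ∧
      ∃ U : ℝ → H, ContinuousOn U (Icc 0 T) ∧ U 0 = u₀ ∧
        (∀ᵐ t ∂(volume.restrict (Ioo 0 T)), U t = j (u t)) ∧
        ∀ (C K : ℝ) (e : V → ℝ), 0 < C → 0 ≤ K → LipschitzWith 1 e → e 0 = 0 →
          (∀ v, C * e v ^ 2 ≤ B v v) → (∀ v, ‖v‖ ^ 2 ≤ K * e v ^ 2) → ∀ t ∈ Ioc 0 T,
            ‖U t‖ ^ 2 + C * ∫ s in Ioo 0 t, e (u s) ^ 2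
              ≤ ‖u₀‖ ^ 2 + K / C * ∫ s in Ioo 0 t, ‖f s‖ ^ 2 := by
  obtain ⟨w, w', u, U, hwc', hw, hR, hu, hwu, hUc, hU0, hU, hUu⟩ :=
    exists_limit_of_approximate_solutions j B hc hl hB hT hf hu₀
  have hwc : ∀ k, Continuous (w k) := fun k =>
    continuous_iff_continuousAt.2 fun t => (hw k t).continuousAt
  let R : ℕ → ℝ → StrongDual ℝ V := fun k t => massForm j (w' k t) + B (w k t)
  have hRc : ∀ k, Continuous (R k) := fun k =>
    ((massForm j).continuous.comp (hwc' k)).add (B.continuous.comp (hwc k))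
  refine ⟨u, hu, fun v φ hφ _ hφT => ?_, U, hUc, hU0, hUu, ?_⟩
  · have hψ := hφ.continuous.memLp_two_Ioo 0 T
    have hψ' := hφ.continuous_deriv_smooth.memLp_two_Ioo 0 T
    have hwm := fun k => (hwc k).memLp_two_Ioo 0 T
    have t1 := tendsto_integral_clm_mul hwm hu hwu ((massForm j).flip v) hψ'
    have t2 := tendsto_integral_clm_mul hwm hu hwu (B.flip v) hψ
    have t3 := tendsto_integral_clm_mul (fun k => (hRc k).memLp_two_Ioo 0 T) hf hR
      (ContinuousLinearMap.apply ℝ ℝ v) hψ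
    have t4 : Tendsto (fun k => ⟪j (w k 0), j v⟫_ℝ * φ 0) atTop (𝓝 (⟪u₀, j v⟫_ℝ * φ 0)) := by
      rw [← hU0]
      exact ((hU 0 ⟨le_rfl, hT⟩).inner tendsto_const_nhds).mul_const _
    refine tendsto_nhds_unique (t1.neg.add t2) ((t3.add t4).congr fun k => ?_)
    exact (weak_formulation_of_hasDerivAt j B hT (hwc' k) (hw k) v hφ hφT).symm
  · rintro C K e hC hK he he0 hCe hKe t ⟨ht0, htT⟩
    -- Full coercivity allows l = 0, so no exponential factor appears. Here `e` stands for the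
    -- energy seminorm and K for the squared Poincaré constant; ‖v‖² ≤ K e(v)² lets Young's
    -- inequality absorb S v into e(v)².
    have hqB : ∀ (v : V) (S : StrongDual ℝ V), 2 * S v - 2 * B v v
        ≤ 2 * 0 * ‖j v‖ ^ 2 - C * e v ^ 2 + K / C * ‖S‖ ^ 2 := by
      intro v S
      have h2 : S v ≤ ‖S‖ * ‖v‖ := (le_abs_self _).trans (S.le_opNorm v)
      have h3 : 2 * (‖S‖ * ‖v‖) ≤ C * e v ^ 2 + K / C * ‖S‖ ^ 2 := by
        refine le_of_sq_le_sq ?_ (by positivity)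
        have h4 : (‖S‖ * ‖v‖) ^ 2 ≤ (C * e v ^ 2) * (K / C * ‖S‖ ^ 2) := by
          calc (‖S‖ * ‖v‖) ^ 2 = ‖S‖ ^ 2 * ‖v‖ ^ 2 := mul_pow _ _ _
            _ ≤ ‖S‖ ^ 2 * (K * e v ^ 2) := by gcongr; exact hKe v
            _ = _ := by field_simp
        nlinarith [sq_nonneg (C * e v ^ 2 - K / C * ‖S‖ ^ 2)]
      linarith [hCe v]
    have hest : ∀ k, ‖j (w k t)‖ ^ 2 + C * ∫ s in Ioo 0 t, e (w k s) ^ 2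
        ≤ ‖j (w k 0)‖ ^ 2 + K / C * ∫ s in Ioo 0 t, ‖R k s‖ ^ 2 := by
      intro k
      have := energy_estimate j B (ε := 0) le_rfl le_rfl (q := fun v => C * e v ^ 2)
        (continuous_const.mul (he.continuous.pow 2)) hqB (hw k) (hRc k)
        (fun t => by simp only [zero_smul, add_zero, R]) ht0.le
      simpa [setIntegral_Ioo_eq_intervalIntegral _ ht0.le] using this
    have hle : (volume : Measure ℝ).restrict (Ioo 0 t) ≤ volume.restrict (Ioo 0 T) :=
      Measure.restrict_mono (Ioo_subset_Ioo_right htT) le_rfl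
    have hmono : ∀ {F : Type _} [NormedAddCommGroup F] {g : ℕ → ℝ → F},
        Tendsto (fun k => eLpNorm (g k) 2 (volume.restrict (Ioo 0 T))) atTop (𝓝 0) →
        Tendsto (fun k => eLpNorm (g k) 2 (volume.restrict (Ioo 0 t))) atTop (𝓝 0) :=
      fun hg => tendsto_of_tendsto_of_tendsto_of_le_of_le tendsto_const_nhds hg
        (fun k => zero_le) fun k => eLpNorm_mono_measure _ hle
    have t1 := tendsto_integral_sq_of_lipschitz (fun k => (hwc k).memLp_two_Ioo 0 t)
      (hu.mono_measure hle) (hmono hwu) he he0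
    have t2 := tendsto_integral_sq_of_lipschitz (fun k => (hRc k).memLp_two_Ioo 0 t)
      (hf.mono_measure hle) (hmono hR) (e := norm) lipschitzWith_one_norm norm_zero
    have t3 := (hU t ⟨ht0.le, htT⟩).norm.pow 2
    have t4 := (hU 0 ⟨le_rfl, hT⟩).norm.pow 2
    rw [hU0] at t4
    exact le_of_tendsto_of_tendsto' (t3.add (t1.const_mul C)) (t4.add (t2.const_mul (K / C))) hest

end Existence

end

noncomputable section

/-! ### Uniqueness of weak solutions. -/

section Uniqueness

/-- Smooth functions with compact support in `(0,T)` are derivatives, on `(0,T)`, of test functions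
with compact support in `(-∞,T)`. -/
theorem exists_test_function_deriv_eq {T : ℝ} (hT : 0 < T) {ψ : ℝ → ℝ}
    (hψ : ContDiff ℝ (⊤ : ℕ∞) ψ) (hψc : HasCompactSupport ψ) (hψT : tsupport ψ ⊆ Ioo 0 T) :
    ∃ φ : ℝ → ℝ, ContDiff ℝ (⊤ : ℕ∞) φ ∧ HasCompactSupport φ ∧ tsupport φ ⊆ Iio T ∧
      ∀ t ∈ Icc 0 T, HasDerivAt φ (ψ t) t := by
  obtain ⟨s, hsT, hs⟩ : ∃ s < T, ∀ t ∈ tsupport ψ, t ≤ s := by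
    rcases (tsupport ψ).eq_empty_or_nonempty with h | h
    · exact ⟨T - 1, by linarith, by simp [h]⟩
    · obtain ⟨s, hs⟩ := hψc.isCompact.exists_isGreatest h
      exact ⟨s, (hψT hs.1).2, hs.2⟩
  -- Starting the primitive at T makes it vanish to the right of supp ψ. To the left it may be a
  -- nonzero constant, which the cutoff χ removes away from [0,T].
  let Ψ : ℝ → ℝ := fun t => ∫ x in T..t, ψ x
  have hΨd : ∀ t, HasDerivAt Ψ (ψ t) t := fun t =>
    (hψ.continuous.integral_hasStrictDerivAt T t).hasDerivAt
  have hΨ : ContDiff ℝ (⊤ : ℕ∞) Ψ := by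
    refine contDiff_infty_iff_deriv.2 ⟨fun t => (hΨd t).differentiableAt, ?_⟩
    have : deriv Ψ = ψ := funext fun t => (hΨd t).deriv
    rwa [this]
  have hΨ0 : ∀ t, s < t → Ψ t = 0 := by
    intro t ht
    refine intervalIntegral.integral_zero_ae (Eventually.of_forall fun x hx => ?_)
    refine image_eq_zero_of_notMem_tsupport fun h => ?_
    have h1 : min T t < x := hx.1
    exact absurd (hs x h) (not_le.2 ((lt_min hsT ht).trans h1))
  let χ : ContDiffBump (0 : ℝ) := ⟨T + 1, T + 2, by linarith, by linarith⟩
  have hχ : ∀ t ∈ Icc 0 T, χ =ᶠ[𝓝 t] fun _ => 1 := by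
    intro t ht
    filter_upwards [Metric.ball_mem_nhds t one_pos] with x hx
    refine χ.one_of_mem_closedBall ?_
    rw [mem_closedBall_zero_iff, Real.norm_eq_abs]
    rw [Metric.mem_ball, Real.dist_eq] at hx
    have := abs_lt.1 hx
    change |x| ≤ T + 1
    exact abs_le.2 ⟨by linarith [ht.1], by linarith [ht.2]⟩
  refine ⟨fun t => χ t * Ψ t, χ.contDiff.mul hΨ, χ.hasCompactSupport.mul_right, ?_, ?_⟩
  · have hsub : Function.support (fun t => χ t * Ψ t) ⊆ Iic s := by
      intro t ht
      by_contra h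
      exact ht (by simp only [hΨ0 t (not_le.1 h), mul_zero])
    exact (closure_minimal hsub isClosed_Iic).trans fun t ht => lt_of_le_of_lt ht hsT
  · intro t ht
    refine (hΨd t).congr_of_eventuallyEq ?_
    filter_upwards [hχ t ht] with x hx
    simp [hx]

/-- If `a' + b = 0` on `(0,T)` and `a(0) = 0` in the sense of distributions, then
`a(t) + ∫₀ᵗ b = 0` for almost every `t`. -/
theorem ae_add_integral_eq_zero_of_weak_derivative {T : ℝ} (hT : 0 < T) {a b : ℝ → ℝ}
    (ha : IntervalIntegrable a volume 0 T) (hb : IntervalIntegrable b volume 0 T)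
    (hab : ∀ φ : ℝ → ℝ, ContDiff ℝ (⊤ : ℕ∞) φ → HasCompactSupport φ → tsupport φ ⊆ Iio T →
      -(∫ t in Ioo 0 T, a t * deriv φ t) + ∫ t in Ioo 0 T, b t * φ t = 0) :
    ∀ᵐ t, t ∈ Ioo 0 T → a t + ∫ s in (0 : ℝ)..t, b s = 0 := by
  have hbAC := hb.absolutelyContinuousOnInterval_intervalIntegral (c := 0) (by simp)
  have hbi : IntervalIntegrable (fun t => ∫ s in (0 : ℝ)..t, b s) volume 0 T :=
    hbAC.continuousOn.intervalIntegrable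
  have hloc : LocallyIntegrableOn (fun t => a t + ∫ s in (0 : ℝ)..t, b s) (Ioo 0 T) := by
    refine IntegrableOn.locallyIntegrableOn ?_
    have := (ha.add hbi).1
    exact this.mono_set Ioo_subset_Ioc_self
  refine isOpen_Ioo.ae_eq_zero_of_integral_contDiff_smul_eq_zero hloc fun ψ hψ hψc hψT => ?_
  -- Since φ(0) need not vanish, ψ need not have mean zero. This rules out the additive constant of
  -- the du Bois-Reymond lemma and expresses a(0) = 0.
  obtain ⟨φ, hφ, hφc, hφT, hφd⟩ := exists_test_function_deriv_eq hT hψ hψc hψT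
  have hφAC : AbsolutelyContinuousOnInterval φ 0 T :=
    (hφ.of_le (by simp)).contDiffOn.absolutelyContinuousOnInterval
  -- The boundary terms vanish: φ is zero at T and the primitive of b is zero at 0.
  have hparts := hbAC.integral_mul_deriv_eq_deriv_mul hφAC
  have hφ0 : φ T = 0 := image_eq_zero_of_notMem_tsupport fun h => lt_irrefl T (hφT h)
  rw [hφ0, intervalIntegral.integral_same, mul_zero, zero_mul, sub_zero, zero_sub] at hparts
  have hderiv : ∫ x in (0 : ℝ)..T, deriv (fun x => ∫ v in (0 : ℝ)..x, b v) x * φ x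
      = ∫ x in (0 : ℝ)..T, b x * φ x := by
    refine intervalIntegral.integral_congr_ae ?_
    filter_upwards [hb.ae_hasDerivAt_integral] with x hx hxT
    rw [(hx (uIoc_subset_uIcc hxT) 0 (by simp)).deriv]
  rw [hderiv] at hparts
  have hab' := hab φ hφ hφc hφT
  rw [setIntegral_Ioo_eq_intervalIntegral _ hT.le, setIntegral_Ioo_eq_intervalIntegral _ hT.le]
    at hab'
  have h1 : ∫ x, ψ x • (a x + ∫ s in (0 : ℝ)..x, b s)
      = ∫ x in (0 : ℝ)..T, ψ x • (a x + ∫ s in (0 : ℝ)..x, b s) := by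
    rw [← setIntegral_Ioo_eq_intervalIntegral _ hT.le]
    refine (setIntegral_eq_integral_of_forall_compl_eq_zero fun x hx => ?_).symm
    rw [image_eq_zero_of_notMem_tsupport fun h => hx (hψT h), zero_smul]
  have hdc := hφ.continuous_deriv_smooth
  have h2 : ∫ x in (0 : ℝ)..T, ψ x • (a x + ∫ s in (0 : ℝ)..x, b s)
      = ∫ x in (0 : ℝ)..T, (a x * deriv φ x + (∫ s in (0 : ℝ)..x, b s) * deriv φ x) := by
    refine intervalIntegral.integral_congr fun x hx => ?_
    rw [uIcc_of_le hT.le] at hx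
    simp only [(hφd x hx).deriv, smul_eq_mul]
    ring
  rw [h1, h2, intervalIntegral.integral_add (ha.mul_continuousOn hdc.continuousOn)
    (hbi.mul_continuousOn hdc.continuousOn), hparts]
  linarith

variable {V H : Type*} [NormedAddCommGroup V] [InnerProductSpace ℝ V]
  [NormedAddCommGroup H] [InnerProductSpace ℝ H]

/-- A weak solution with vanishing data vanishes. -/
theorem ae_eq_zero_of_weak_solution [CompleteSpace V] (j : V →L[ℝ] H)
    (B : V →L[ℝ] StrongDual ℝ V) {c l T : ℝ} (hc : 0 < c) (hl : 0 ≤ l)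
    (hB : ∀ v, c * ‖v‖ ^ 2 ≤ B v v + l * ‖j v‖ ^ 2) (hT : 0 < T) {w : ℝ → V}
    (hw : MemLp w 2 (volume.restrict (Ioo 0 T)))
    (hweak : ∀ v : V, ∀ φ : ℝ → ℝ, ContDiff ℝ (⊤ : ℕ∞) φ → HasCompactSupport φ →
      tsupport φ ⊆ Iio T →
      -(∫ t in Ioo 0 T, ⟪j (w t), j v⟫_ℝ * deriv φ t) + ∫ t in Ioo 0 T, B (w t) v * φ t = 0) :
    w =ᵐ[volume.restrict (Ioo 0 T)] 0 := by
  let z : ℝ → V := (Ioo 0 T).indicator w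
  have hz : Integrable z := (integrable_indicator_iff measurableSet_Ioo).2
    (hw.integrable (by norm_num))
  have hzw : ∀ t ∈ Ioo 0 T, z t = w t := fun t ht => indicator_of_mem ht w
  let W : ℝ → V := fun t => ∫ s in (0 : ℝ)..t, z s
  have hWc : Continuous W := intervalIntegral.continuous_primitive
    (fun a b => hz.intervalIntegrable) 0
  -- The solution need not have a time derivative in V, so the energy estimate does not apply to it
  -- directly. Its second primitive Z is C¹ with values in V and solves the same autonomous equation
  -- with zero data.
  let Z : ℝ → V := fun t => ∫ s in (0 : ℝ)..t, W s
  have hZ : ∀ t, HasDerivAt Z (W t) t := fun t => (hWc.integral_hasStrictDerivAt 0 t).hasDerivAt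
  have hZc : Continuous Z := continuous_iff_continuousAt.2 fun t => (hZ t).continuousAt
  let R : ℝ → StrongDual ℝ V := fun t => massForm j (W t) + B (Z t)
  have hRc : Continuous R :=
    ((massForm j).continuous.comp hWc).add (B.continuous.comp hZc)
  have hR : ∀ t ∈ Icc 0 T, R t = 0 := by
    intro t ht
    ext v
    have hI : ∀ Λ : StrongDual ℝ V, Integrable fun s => Λ (z s) := fun Λ => Λ.integrable_comp hz
    have hWΛ : ∀ (Λ : StrongDual ℝ V) (s : ℝ), ∫ x in (0 : ℝ)..s, Λ (z x) = Λ (W s) :=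
      fun Λ s => Λ.intervalIntegral_comp_comm hz.intervalIntegrable
    have hscal := ae_add_integral_eq_zero_of_weak_derivative hT
      (a := fun s => (massForm j).flip v (z s)) (b := fun s => B.flip v (z s))
      (hI _).intervalIntegrable (hI _).intervalIntegrable (by
        intro φ h1 h2 h3
        refine Eq.trans ?_ (hweak v φ h1 h2 h3)
        refine congrArg₂ (· + ·) (congrArg Neg.neg ?_) ?_
        · refine setIntegral_congr_fun measurableSet_Ioo fun s hs => ?_
          simp only [hzw s hs]; rfl
        · refine setIntegral_congr_fun measurableSet_Ioo fun s hs => ?_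
          simp only [hzw s hs]; rfl)
    -- The null set in `hscal` depends on v; one more integration gives an identity at every t.
    have h0 : ∫ s in (0 : ℝ)..t, ((massForm j).flip v (z s) + B.flip v (W s)) = 0 := by
      refine intervalIntegral.integral_zero_ae ?_
      have hne : ∀ᵐ s : ℝ, s ≠ T := by simp [ae_iff]
      filter_upwards [hscal, hne] with s hs hsT hst
      rw [uIoc_of_le ht.1] at hst
      have := hs ⟨hst.1, lt_of_le_of_ne (hst.2.trans ht.2) hsT⟩
      rwa [hWΛ] at this
    have hBW : Continuous fun s => B.flip v (W s) := (B.flip v).continuous.comp hWc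
    rw [intervalIntegral.integral_add (hI _).intervalIntegrable (hBW.intervalIntegrable _ _), hWΛ,
      (B.flip v).intervalIntegral_comp_comm (hWc.intervalIntegrable _ _)] at h0
    exact h0
  have hest := (energy_estimate_of_weaklyCoercive j B (ε := 0) hc hl le_rfl hB hZ hRc
    (fun t => by simp only [zero_smul, add_zero, R]) hT.le).2
  have hR0 : ∫ s in Ioo 0 T, ‖R s‖ ^ 2 = 0 :=
    setIntegral_eq_zero_of_forall_eq_zero fun s hs => by simp [hR s (Ioo_subset_Icc_self hs)]
  have hZ0 : Z 0 = 0 := intervalIntegral.integral_same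
  rw [hR0, hZ0] at hest
  simp only [map_zero, norm_zero, mul_zero, add_zero, ne_eq, OfNat.ofNat_ne_zero,
    not_false_eq_true, zero_pow] at hest
  have hZint : ∫ s in Ioo 0 T, ‖Z s‖ ^ 2 = 0 :=
    le_antisymm (by nlinarith) (integral_nonneg fun s => by positivity)
  have hZae : Z =ᵐ[volume.restrict (Ioo 0 T)] 0 := by
    have := (integral_eq_zero_iff_of_nonneg (fun s => by positivity)
      ((hZc.memLp_two_Ioo 0 T).integrable_norm_pow (by norm_num))).1 hZint
    filter_upwards [this] with s hs
    simpa using hs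
  have hZeq : EqOn Z 0 (Ioo 0 T) := Measure.eqOn_open_of_ae_eq hZae isOpen_Ioo hZc.continuousOn
    continuousOn_const
  have hWeq : EqOn W 0 (Ioo 0 T) := fun t ht =>
    (hZ t).unique ((hasDerivAt_const t (0 : V)).congr_of_eventuallyEq
      (hZeq.eventuallyEq_of_mem (isOpen_Ioo.mem_nhds ht)))
  rw [Filter.EventuallyEq, ae_restrict_iff' measurableSet_Ioo]
  -- Since z is only integrable, the second differentiation is Lebesgue's theorem.
  filter_upwards [(hz.intervalIntegrable (a := 0) (b := T)).ae_hasDerivAt_integral] with t h1 ht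
  rw [← hzw t ht]
  exact (h1 (by rw [uIcc_of_le hT.le]; exact Ioo_subset_Icc_self ht) 0 (by simp)).unique
    ((hasDerivAt_const t (0 : V)).congr_of_eventuallyEq
      (hWeq.eventuallyEq_of_mem (isOpen_Ioo.mem_nhds ht)))

end Uniqueness

end

noncomputable section

/-! ### The Cauchy–Schwarz inequality with a weight. -/

section CauchySchwarz

/-- Hölder's inequality for p √q and √q. -/
theorem lintegral_mul_sq_le {X : Type*} [MeasurableSpace X] (μ : Measure X) {p q : X → ℝ≥0∞}
    (hp : Measurable p) (hq : Measurable q) :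
    (∫⁻ x, p x * q x ∂μ) ^ 2 ≤ (∫⁻ x, p x ^ 2 * q x ∂μ) * ∫⁻ x, q x ∂μ := by
  have hsq : ∀ r : ℝ≥0∞, (r ^ (1 / 2 : ℝ)) ^ 2 = r := by
    intro r
    rw [← ENNReal.rpow_natCast, ← ENNReal.rpow_mul]
    norm_num
  have h := ENNReal.lintegral_mul_le_Lp_mul_Lq μ (Real.HolderConjugate.two_two)
    (f := fun x => p x * q x ^ (1 / 2 : ℝ)) (g := fun x => q x ^ (1 / 2 : ℝ))
    (hp.mul (hq.pow_const _)).aemeasurable (hq.pow_const _).aemeasurable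
  simp only [ENNReal.rpow_two, mul_pow, hsq, Pi.mul_apply] at h
  have h1 : ∀ x, p x * q x ^ (1 / 2 : ℝ) * q x ^ (1 / 2 : ℝ) = p x * q x := fun x => by
    rw [mul_assoc, ← sq, hsq]
  simp only [h1] at h
  calc _ ≤ _ := pow_le_pow_left₀ zero_le h 2
    _ = _ := by rw [mul_pow, hsq, hsq]

end CauchySchwarz

/-! ### Symmetrisation of triple integrals. -/

section TripleIntegrals

variable {X : Type*} [MeasurableSpace X] (μ : Measure X) [SFinite μ]

/-- The exchange of the last two of three points. -/
def swapLast (X : Type*) [MeasurableSpace X] : X × X × X ≃ᵐ X × X × X :=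
  (MeasurableEquiv.refl X).prodCongr MeasurableEquiv.prodComm

/-- The exchange of the first two of three points. -/
def swapFirst (X : Type*) [MeasurableSpace X] : X × X × X ≃ᵐ X × X × X :=
  (MeasurableEquiv.prodAssoc.symm.trans
    (MeasurableEquiv.prodComm.prodCongr (MeasurableEquiv.refl X))).trans MeasurableEquiv.prodAssoc

theorem measurePreserving_swapLast :
    MeasurePreserving (swapLast X) (μ.prod (μ.prod μ)) (μ.prod (μ.prod μ)) :=
  (MeasurePreserving.id μ).prod Measure.measurePreserving_swap

theorem measurePreserving_swapFirst :
    MeasurePreserving (swapFirst X) (μ.prod (μ.prod μ)) (μ.prod (μ.prod μ)) :=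
  (measurePreserving_prodAssoc μ μ μ).comp
    ((Measure.measurePreserving_swap.prod (MeasurePreserving.id μ)).comp
      (measurePreserving_prodAssoc μ μ μ).symm)

theorem integral_swapLast (F : X × X × X → ℝ) :
    ∫ t, F (t.1, t.2.2, t.2.1) ∂μ.prod (μ.prod μ) = ∫ t, F t ∂μ.prod (μ.prod μ) :=
  (measurePreserving_swapLast μ).integral_comp' F

theorem integral_swapFirst (F : X × X × X → ℝ) :
    ∫ t, F (t.2.1, t.1, t.2.2) ∂μ.prod (μ.prod μ) = ∫ t, F t ∂μ.prod (μ.prod μ) :=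
  (measurePreserving_swapFirst μ).integral_comp' F

theorem integral_swapOuter (F : X × X × X → ℝ) :
    ∫ t, F (t.2.2, t.2.1, t.1) ∂μ.prod (μ.prod μ) = ∫ t, F t ∂μ.prod (μ.prod μ) := by
  rw [← integral_swapLast μ F, ← integral_swapFirst μ fun t => F (t.1, t.2.2, t.2.1),
    ← integral_swapLast]

variable {μ}

theorem integrable_swapLast {F : X × X × X → ℝ} (hF : Integrable F (μ.prod (μ.prod μ))) :
    Integrable (fun t : X × X × X => F (t.1, t.2.2, t.2.1)) (μ.prod (μ.prod μ)) :=
  (measurePreserving_swapLast μ).integrable_comp_of_integrable hF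

theorem integrable_swapFirst {F : X × X × X → ℝ} (hF : Integrable F (μ.prod (μ.prod μ))) :
    Integrable (fun t : X × X × X => F (t.2.1, t.1, t.2.2)) (μ.prod (μ.prod μ)) :=
  (measurePreserving_swapFirst μ).integrable_comp_of_integrable hF

theorem integrable_swapOuter {F : X × X × X → ℝ} (hF : Integrable F (μ.prod (μ.prod μ))) :
    Integrable (fun t : X × X × X => F (t.2.2, t.2.1, t.1)) (μ.prod (μ.prod μ)) :=
  integrable_swapLast (integrable_swapFirst (integrable_swapLast hF))

/-- Symmetrisation of `(v(y) - v(x)) (u(z) - u(x)) k(x,y,z)` for a kernel that is symmetric in its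
last two points. -/
theorem integral_symmetrise {k : X × X × X → ℝ} (hk : ∀ x y z, k (x, y, z) = k (x, z, y))
    {u v : X → ℝ}
    (huv : Integrable (fun t => (u t.2.1 - u t.1) * (v t.2.1 - v t.1) * k t) (μ.prod (μ.prod μ)))
    (hvu : Integrable (fun t => (v t.2.1 - v t.1) * (u t.2.2 - u t.1) * k t)
      (μ.prod (μ.prod μ))) :
    ∫ t, (v t.2.1 - v t.1) * (u t.2.2 - u t.1) * k t ∂μ.prod (μ.prod μ)
      = ∫ p : X × X, (u p.2 - u p.1) * (v p.2 - v p.1) * ((1 / 2 : ℝ) *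
        ∫ z, (k (p.1, p.2, z) - k (z, p.2, p.1) + k (p.2, p.1, z)) ∂μ) ∂μ.prod μ := by
  have hk' : ∀ t : X × X × X, k (t.1, t.2.2, t.2.1) = k t := fun t => hk _ _ _
  have huv2 : Integrable (fun t => (u t.2.2 - u t.1) * (v t.2.2 - v t.1) * k t)
      (μ.prod (μ.prod μ)) := by
    have := integrable_swapLast huv
    simpa only [hk'] using this
  have hvu2 : Integrable (fun t => (v t.2.2 - v t.1) * (u t.2.1 - u t.1) * k t)
      (μ.prod (μ.prod μ)) := by
    have := integrable_swapLast hvu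
    simpa only [hk'] using this
  have huv2_eq : ∫ t, (u t.2.2 - u t.1) * (v t.2.2 - v t.1) * k t ∂μ.prod (μ.prod μ)
      = ∫ t, (u t.2.1 - u t.1) * (v t.2.1 - v t.1) * k t ∂μ.prod (μ.prod μ) := by
    rw [← integral_swapLast]
    simp only [hk']
  have hvu2_eq : ∫ t, (v t.2.2 - v t.1) * (u t.2.1 - u t.1) * k t ∂μ.prod (μ.prod μ)
      = ∫ t, (v t.2.1 - v t.1) * (u t.2.2 - u t.1) * k t ∂μ.prod (μ.prod μ) := by
    rw [← integral_swapLast]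
    simp only [hk']
  -- Let P and Q be the integrals of the functions in `huv` and `hvu`. Expanding both differences
  -- between y and z about x gives an integral D = 2P - 2Q.
  have hdec : (fun t : X × X × X => (u t.2.1 - u t.2.2) * (v t.2.1 - v t.2.2) * k t)
      = fun t => ((u t.2.1 - u t.1) * (v t.2.1 - v t.1) * k t
        + (u t.2.2 - u t.1) * (v t.2.2 - v t.1) * k t)
        - ((v t.2.1 - v t.1) * (u t.2.2 - u t.1) * k t
        + (v t.2.2 - v t.1) * (u t.2.1 - u t.1) * k t) := by
    funext t; ring
  have hd : Integrable (fun t : X × X × X => (u t.2.1 - u t.2.2) * (v t.2.1 - v t.2.2) * k t)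
      (μ.prod (μ.prod μ)) := by
    rw [hdec]; exact (huv.add huv2).sub (hvu.add hvu2)
  have hd_eq : ∫ t : X × X × X, (u t.2.1 - u t.2.2) * (v t.2.1 - v t.2.2) * k t
        ∂μ.prod (μ.prod μ)
      = 2 * (∫ t, (u t.2.1 - u t.1) * (v t.2.1 - v t.1) * k t ∂μ.prod (μ.prod μ))
        - 2 * ∫ t, (v t.2.1 - v t.1) * (u t.2.2 - u t.1) * k t ∂μ.prod (μ.prod μ) := by
    have e1 := integral_sub (huv.add huv2) (hvu.add hvu2)
    have e2 := integral_add huv huv2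
    have e3 := integral_add hvu hvu2
    simp only [Pi.add_apply] at e1 e2 e3
    rw [hdec, e1, e2, e3, huv2_eq, hvu2_eq]
    ring
  have hout := integrable_swapOuter hd
  have hout_eq := integral_swapOuter μ
    fun t : X × X × X => (u t.2.1 - u t.2.2) * (v t.2.1 - v t.2.2) * k t
  have hfst := integrable_swapFirst huv
  have hfst_eq := integral_swapFirst μ
    fun t : X × X × X => (u t.2.1 - u t.1) * (v t.2.1 - v t.1) * k t
  simp only at hout hout_eq hfst hfst_eq
  -- Exchanging x and z in D, and x and y in P, produces the common factor (u(y) - u(x)) (v(y) -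
  -- v(x)). Hence ∫ G = P - D + P = 2Q.
  let G : X × X × X → ℝ := fun t => (u t.2.1 - u t.1) * (v t.2.1 - v t.1)
    * (k t - k (t.2.2, t.2.1, t.1) + k (t.2.1, t.1, t.2.2))
  have hGdec : G = fun t => ((u t.2.1 - u t.1) * (v t.2.1 - v t.1) * k t
      - (u t.2.1 - u t.1) * (v t.2.1 - v t.1) * k (t.2.2, t.2.1, t.1))
      + (u t.1 - u t.2.1) * (v t.1 - v t.2.1) * k (t.2.1, t.1, t.2.2) := by
    funext t; simp only [G]; ring
  have hG : Integrable G (μ.prod (μ.prod μ)) := by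
    rw [hGdec]; exact (huv.sub hout).add hfst
  have hG_eq : ∫ t, G t ∂μ.prod (μ.prod μ)
      = 2 * ∫ t, (v t.2.1 - v t.1) * (u t.2.2 - u t.1) * k t ∂μ.prod (μ.prod μ) := by
    have e1 := integral_add (huv.sub hout) hfst
    have e2 := integral_sub huv hout
    simp only [Pi.sub_apply] at e1 e2
    rw [hGdec, e1, e2, hout_eq, hfst_eq, hd_eq]
    ring
  have hassoc := (measurePreserving_prodAssoc μ μ μ).integral_comp' G
  have hGi : Integrable (fun s : (X × X) × X => G (MeasurableEquiv.prodAssoc s))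
      ((μ.prod μ).prod μ) :=
    (measurePreserving_prodAssoc μ μ μ).integrable_comp_of_integrable hG
  rw [integral_prod _ hGi, hG_eq] at hassoc
  have hfin : ∀ p : X × X, (u p.2 - u p.1) * (v p.2 - v p.1) * ((1 / 2 : ℝ) *
        ∫ z, (k (p.1, p.2, z) - k (z, p.2, p.1) + k (p.2, p.1, z)) ∂μ)
      = (1 / 2 : ℝ) * ∫ z, G (MeasurableEquiv.prodAssoc (p, z)) ∂μ := by
    intro p
    have : ∀ z, G (MeasurableEquiv.prodAssoc (p, z)) = (u p.2 - u p.1) * (v p.2 - v p.1)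
        * (k (p.1, p.2, z) - k (z, p.2, p.1) + k (p.2, p.1, z)) := fun z => rfl
    simp only [this, integral_const_mul]
    ring
  simp only [hfin, integral_const_mul]
  linarith

end TripleIntegrals

end

noncomputable section

/-! ### The energy of absolutely convergent gradients. -/

section TruncatedGradient

variable {n : ℕ} {b : Rn n → Rn n → Rn n} {A : Rn n → Rn n →L[ℝ] Rn n} {u v : Rn n → ℝ}

/-- The kernel `b(x,y) · A(x) b(x,z)` of the anisotropic energy. -/
def tripleKernel (A : Rn n → Rn n →L[ℝ] Rn n) (b : Rn n → Rn n → Rn n) (t : Rn n × Rn n × Rn n) :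
    ℝ :=
  ⟪b t.1 t.2.1, A t.1 (b t.1 t.2.2)⟫_ℝ

theorem measurable_clm_apply₂ {X : Type*} [MeasurableSpace X] {L : X → Rn n →L[ℝ] Rn n}
    {ξ : X → Rn n} (hL : Measurable L) (hξ : Measurable ξ) : Measurable fun x => L x (ξ x) := by
  have : SecondCountableTopology (Rn n →L[ℝ] Rn n) := by
    have : ProperSpace (Rn n →L[ℝ] Rn n) := FiniteDimensional.proper ℝ _
    infer_instance
  exact (isBoundedBilinearMap_apply (𝕜 := ℝ) (E := Rn n) (F := Rn n)).continuous.measurable.comp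
    (hL.prodMk hξ)

theorem measurable_tripleKernel (hb : Measurable (Function.uncurry b)) (hA : Measurable A) :
    Measurable (tripleKernel A b) := by
  have h1 : Measurable fun t : Rn n × Rn n × Rn n => b t.1 t.2.1 :=
    hb.comp (measurable_fst.prodMk measurable_snd.fst)
  have h2 : Measurable fun t : Rn n × Rn n × Rn n => b t.1 t.2.2 :=
    hb.comp (measurable_fst.prodMk measurable_snd.snd)
  exact h1.inner (measurable_clm_apply₂ (hA.comp measurable_fst) h2)

/-- The absolute energy `∭ |v(y) - v(x)|² |b(x,y)| |b(x,z)| dz dy dx`. -/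
def tripleEnergy (b : Rn n → Rn n → Rn n) (v : Rn n → ℝ) : ℝ≥0∞ :=
  ∫⁻ x, ∫⁻ y, ∫⁻ z, ‖v y - v x‖ₑ ^ 2 * ‖b x y‖ₑ * ‖b x z‖ₑ

theorem integrable_of_tripleEnergy (hb : Measurable (Function.uncurry b)) (hv : Measurable v)
    (hfin : tripleEnergy b v < ∞) :
    Integrable fun t : Rn n × Rn n × Rn n =>
      (v t.2.1 - v t.1) ^ 2 * (‖b t.1 t.2.1‖ * ‖b t.1 t.2.2‖) := by
  have h1 : Measurable fun t : Rn n × Rn n × Rn n => b t.1 t.2.1 :=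
    hb.comp (measurable_fst.prodMk measurable_snd.fst)
  have h2 : Measurable fun t : Rn n × Rn n × Rn n => b t.1 t.2.2 :=
    hb.comp (measurable_fst.prodMk measurable_snd.snd)
  have h3 : Measurable fun t : Rn n × Rn n × Rn n => v t.2.1 - v t.1 :=
    (hv.comp measurable_snd.fst).sub (hv.comp measurable_fst)
  refine ⟨((h3.pow_const 2).mul (h1.norm.mul h2.norm)).aestronglyMeasurable, ?_⟩
  have h4 : Measurable fun t : Rn n × Rn n × Rn n =>
      ‖v t.2.1 - v t.1‖ₑ ^ 2 * ‖b t.1 t.2.1‖ₑ * ‖b t.1 t.2.2‖ₑ :=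
    ((h3.enorm.pow_const 2).mul h1.enorm).mul h2.enorm
  rw [HasFiniteIntegral]
  refine lt_of_eq_of_lt ?_ hfin
  rw [tripleEnergy, Measure.volume_eq_prod, lintegral_prod _ (by
    simp only [enorm_mul, enorm_pow, enorm_norm, ← mul_assoc]; exact h4.aemeasurable)]
  refine lintegral_congr fun x => ?_
  rw [Measure.volume_eq_prod, lintegral_prod]
  · simp only [enorm_mul, enorm_pow, enorm_norm, mul_assoc]
  · simp only [enorm_mul, enorm_pow, enorm_norm, ← mul_assoc]
    exact (h4.comp measurable_prodMk_left).aemeasurable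

/-- From |pq| ≤ p² + q² and the bound Λ on A, the absolute energies of u and v together dominate the
integrand. -/
theorem integrable_two_point_tripleKernel (hb : Measurable (Function.uncurry b))
    (hA : Measurable A) {Λ : ℝ} (hΛ : ∀ x ξ η, |⟪ξ, A x η⟫_ℝ| ≤ Λ * (‖ξ‖ * ‖η‖))
    (hu : Measurable u) (hv : Measurable v) (hfu : tripleEnergy b u < ∞)
    (hfv : tripleEnergy b v < ∞) :
    Integrable (fun t : Rn n × Rn n × Rn n =>
      (u t.2.1 - u t.1) * (v t.2.1 - v t.1) * tripleKernel A b t) := by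
  have hsu := integrable_of_tripleEnergy hb hu hfu
  have hsv := integrable_of_tripleEnergy hb hv hfv
  refine ((hsu.add hsv).const_mul Λ).mono' (Measurable.aestronglyMeasurable ?_)
    (Eventually.of_forall fun t => ?_)
  · exact (((hu.comp measurable_snd.fst).sub (hu.comp measurable_fst)).mul
      ((hv.comp measurable_snd.fst).sub (hv.comp measurable_fst))).mul
      (measurable_tripleKernel hb hA)
  · have h1 := hΛ t.1 (b t.1 t.2.1) (b t.1 t.2.2)
    set p := u t.2.1 - u t.1
    set q := v t.2.1 - v t.1
    set m := ‖b t.1 t.2.1‖ * ‖b t.1 t.2.2‖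
    have h2 : |p * q| ≤ p ^ 2 + q ^ 2 := by
      rw [abs_le]; constructor <;> nlinarith [sq_nonneg (p + q), sq_nonneg (p - q)]
    have h3 : 0 ≤ Λ * m := (abs_nonneg _).trans h1
    simp only [Pi.add_apply]
    rw [Real.norm_eq_abs, abs_mul]
    calc |p * q| * |tripleKernel A b t| ≤ (p ^ 2 + q ^ 2) * (Λ * m) :=
          mul_le_mul h2 h1 (abs_nonneg _) (by positivity)
      _ = _ := by ring

/-- The same domination, with y and z exchanged in the energy of u; the weight |b(x,y)| |b(x,z)| is
unaffected. -/
theorem integrable_three_point_tripleKernel (hb : Measurable (Function.uncurry b))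
    (hA : Measurable A) {Λ : ℝ} (hΛ : ∀ x ξ η, |⟪ξ, A x η⟫_ℝ| ≤ Λ * (‖ξ‖ * ‖η‖))
    (hu : Measurable u) (hv : Measurable v) (hfu : tripleEnergy b u < ∞)
    (hfv : tripleEnergy b v < ∞) :
    Integrable (fun t : Rn n × Rn n × Rn n =>
      (v t.2.1 - v t.1) * (u t.2.2 - u t.1) * tripleKernel A b t) := by
  have hsu := integrable_swapLast (integrable_of_tripleEnergy hb hu hfu)
  have hsv := integrable_of_tripleEnergy hb hv hfv
  refine ((hsu.add hsv).const_mul Λ).mono' (Measurable.aestronglyMeasurable ?_)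
    (Eventually.of_forall fun t => ?_)
  · exact (((hv.comp measurable_snd.fst).sub (hv.comp measurable_fst)).mul
      ((hu.comp measurable_snd.snd).sub (hu.comp measurable_fst))).mul
      (measurable_tripleKernel hb hA)
  · have h1 := hΛ t.1 (b t.1 t.2.1) (b t.1 t.2.2)
    simp only [Pi.add_apply]
    rw [mul_comm ‖b t.1 t.2.2‖]
    set p := u t.2.2 - u t.1
    set q := v t.2.1 - v t.1
    set m := ‖b t.1 t.2.1‖ * ‖b t.1 t.2.2‖
    have h2 : |q * p| ≤ p ^ 2 + q ^ 2 := by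
      rw [abs_le]; constructor <;> nlinarith [sq_nonneg (p + q), sq_nonneg (p - q)]
    have h3 : 0 ≤ Λ * m := (abs_nonneg _).trans h1
    rw [Real.norm_eq_abs, abs_mul]
    calc |q * p| * |tripleKernel A b t| ≤ (p ^ 2 + q ^ 2) * (Λ * m) :=
          mul_le_mul h2 h1 (abs_nonneg _) (by positivity)
      _ = _ := by ring

/-- The Cauchy–Schwarz inequality for the integrand of the truncated gradient. -/
theorem lintegral_gradient_sq_le (hb : Measurable (Function.uncurry b)) (hv : Measurable v)
    (x : Rn n) : (∫⁻ y, ‖(v y - v x) • b x y‖ₑ) ^ 2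
      ≤ ∫⁻ y, ∫⁻ z, ‖v y - v x‖ₑ ^ 2 * ‖b x y‖ₑ * ‖b x z‖ₑ := by
  have h1 : Measurable fun y => ‖b x y‖ₑ := (hb.comp measurable_prodMk_left).enorm
  have h2 : Measurable fun y => ‖v y - v x‖ₑ := (hv.sub_const _).enorm
  simp only [enorm_smul]
  refine (lintegral_mul_sq_le volume h2 h1).trans (le_of_eq ?_)
  have h3 : Measurable fun y => ‖v y - v x‖ₑ ^ 2 * ‖b x y‖ₑ := (h2.pow_const 2).mul h1
  rw [← lintegral_mul_const _ h3]
  refine lintegral_congr fun y => ?_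
  rw [lintegral_const_mul _ h1]

/-- A finite triple integral has finite inner double integrals for almost every x, and these bound
the squared L¹ norm of the integrand. -/
theorem ae_integrable_gradient (hb : Measurable (Function.uncurry b)) (hv : Measurable v)
    (hfin : tripleEnergy b v < ∞) : ∀ᵐ x, Integrable fun y => (v y - v x) • b x y := by
  have hm : Measurable fun x => ∫⁻ y, ∫⁻ z, ‖v y - v x‖ₑ ^ 2 * ‖b x y‖ₑ * ‖b x z‖ₑ := by
    refine Measurable.lintegral_prod_right' (f := fun p : Rn n × Rn n =>
      ∫⁻ z, ‖v p.2 - v p.1‖ₑ ^ 2 * ‖b p.1 p.2‖ₑ * ‖b p.1 z‖ₑ) ?_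
    refine Measurable.lintegral_prod_right' (f := fun t : (Rn n × Rn n) × Rn n =>
      ‖v t.1.2 - v t.1.1‖ₑ ^ 2 * ‖b t.1.1 t.1.2‖ₑ * ‖b t.1.1 t.2‖ₑ) ?_
    have h1 : Measurable fun t : (Rn n × Rn n) × Rn n => b t.1.1 t.1.2 :=
      hb.comp measurable_fst
    have h2 : Measurable fun t : (Rn n × Rn n) × Rn n => b t.1.1 t.2 :=
      hb.comp (measurable_fst.fst.prodMk measurable_snd)
    have h3 : Measurable fun t : (Rn n × Rn n) × Rn n => v t.1.2 - v t.1.1 :=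
      (hv.comp measurable_fst.snd).sub (hv.comp measurable_fst.fst)
    exact ((h3.enorm.pow_const 2).mul h1.enorm).mul h2.enorm
  filter_upwards [ae_lt_top hm hfin.ne] with x hx
  refine ⟨((hv.sub_const _).smul (hb.comp measurable_prodMk_left)).aestronglyMeasurable, ?_⟩
  have h1 := (lintegral_gradient_sq_le hb hv x).trans_lt hx
  rw [HasFiniteIntegral]
  by_contra h
  rw [not_lt, top_le_iff] at h
  rw [h] at h1
  simp at h1

theorem memLp_gradient (hb : Measurable (Function.uncurry b)) (hv : Measurable v)
    (hfin : tripleEnergy b v < ∞) : MemLp (fun x => ∫ y, (v y - v x) • b x y) 2 := by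
  have hm : StronglyMeasurable fun x => ∫ y, (v y - v x) • b x y := by
    refine StronglyMeasurable.integral_prod_right' (f := fun p : Rn n × Rn n =>
      (v p.2 - v p.1) • b p.1 p.2) ?_
    exact (((hv.comp measurable_snd).sub (hv.comp measurable_fst)).smul hb).stronglyMeasurable
  refine ⟨hm.aestronglyMeasurable, ?_⟩
  rw [eLpNorm_lt_top_iff_lintegral_rpow_enorm_lt_top (by norm_num) (by norm_num)]
  refine lt_of_le_of_lt (lintegral_mono fun x => ?_) hfin
  simp only [ENNReal.toReal_ofNat, ENNReal.rpow_two]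
  exact (pow_le_pow_left₀ zero_le (enorm_integral_le_lintegral_enorm _) 2).trans
    (lintegral_gradient_sq_le hb hv x)

/-- The anisotropic energy of absolutely convergent gradients is the unweighted energy of the
symmetrised kernel. -/
theorem integral_inner_gradient_eq (hb : Measurable (Function.uncurry b)) (hA : Measurable A)
    (hA_symm : ∀ x, (A x : Rn n →ₗ[ℝ] Rn n).IsSymmetric)
    {Λ : ℝ} (hΛ : ∀ x ξ η, |⟪ξ, A x η⟫_ℝ| ≤ Λ * (‖ξ‖ * ‖η‖))
    (hu : Measurable u) (hv : Measurable v) (hfu : tripleEnergy b u < ∞)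
    (hfv : tripleEnergy b v < ∞) :
    ∫ x, ⟪∫ y, (v y - v x) • b x y, A x (∫ z, (u z - u x) • b x z)⟫_ℝ
      = ∫ p : Rn n × Rn n, (u p.2 - u p.1) * (v p.2 - v p.1) * ((1 / 2 : ℝ) *
        ∫ z, (tripleKernel A b (p.1, p.2, z) - tripleKernel A b (z, p.2, p.1)
          + tripleKernel A b (p.2, p.1, z))) := by
  have hk : ∀ x y z, tripleKernel A b (x, y, z) = tripleKernel A b (x, z, y) := by
    intro x y z
    have := hA_symm x (b x z) (b x y)
    simp only [ContinuousLinearMap.coe_coe] at this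
    simp only [tripleKernel]
    rw [← this, real_inner_comm]
  have h2 := integrable_two_point_tripleKernel hb hA hΛ hu hv hfu hfv
  have h3 : Integrable (fun t : Rn n × Rn n × Rn n =>
      (v t.2.1 - v t.1) * (u t.2.2 - u t.1) * tripleKernel A b t)
      ((volume : Measure (Rn n)).prod ((volume : Measure (Rn n)).prod volume)) :=
    integrable_three_point_tripleKernel hb hA hΛ hu hv hfu hfv
  have hsym := integral_symmetrise (μ := (volume : Measure (Rn n))) hk h2 h3
  refine Eq.trans ?_ hsym
  rw [integral_prod _ h3]
  refine integral_congr_ae ?_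
  -- For almost every x both gradients converge absolutely, so both integrals can be taken out of
  -- the inner product.
  filter_upwards [ae_integrable_gradient hb hu hfu, ae_integrable_gradient hb hv hfv,
    h3.prod_right_ae] with x hxu hxv hx3
  rw [integral_prod _ hx3, real_inner_comm, ← integral_inner hxv]
  refine integral_congr_ae (Eventually.of_forall fun y => ?_)
  simp only
  rw [real_inner_comm, ← (A x).integral_comp_comm hxu,
    ← integral_inner ((A x).integrable_comp hxu)]
  refine integral_congr_ae (Eventually.of_forall fun z => ?_)
  simp only [tripleKernel, map_smul, real_inner_smul_left, real_inner_smul_right]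
  ring

end TruncatedGradient

end

noncomputable section

/-! ### Equality of the anisotropic and the unweighted form. -/

section EquivalenceIdentity

variable {n : ℕ} {α : Rn n → Rn n → Rn n} {ω : Rn n → Rn n → ℝ} {A S : Rn n → Rn n →L[ℝ] Rn n}
  {Ω : Set (Rn n)}

theorem measurable_truncWeight (hω : Measurable (Function.uncurry ω)) (ε : ℝ) :
    Measurable (Function.uncurry (truncWeight ε ω)) := by
  classical
  have h : Function.uncurry (truncWeight ε ω)
      = {p : Rn n × Rn n | ε ≤ dist p.1 p.2}.indicator (Function.uncurry ω) := by
    funext p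
    simp only [Function.uncurry, truncWeight, indicator, mem_ofPred_eq]
  rw [h]
  exact hω.indicator (measurableSet_le measurable_const measurable_dist)

/-- The truncated vector weight `ω_ε α`. -/
def truncVec (ω : Rn n → Rn n → ℝ) (α : Rn n → Rn n → Rn n) (ε : ℝ) (x y : Rn n) : Rn n :=
  truncWeight ε ω x y • α x y

theorem measurable_truncVec (hω : Measurable (Function.uncurry ω))
    (hα : Measurable (Function.uncurry α)) (ε : ℝ) :
    Measurable (Function.uncurry (truncVec ω α ε)) :=
  (measurable_truncWeight hω ε).smul hα

theorem weightedGrad_truncWeight (u : Rn n → ℝ) (ε : ℝ) (x : Rn n) :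
    weightedGrad (truncWeight ε ω) α u x = ∫ y, (u y - u x) • truncVec ω α ε x y := by
  simp only [weightedGrad, truncVec, smul_smul, mul_comm]

/-- The upper bound controls only the diagonal of the form; writing ξ · Aη = Sξ · Sη and applying
Cauchy–Schwarz gives the rest. The maximum with 0 is there because no sign of `lmax` is assumed. -/
theorem abs_inner_le_of_sqrt {lmax : ℝ} (hA_upper : ∀ x ξ, ⟪ξ, A x ξ⟫_ℝ ≤ lmax * ‖ξ‖ ^ 2)
    (hS_symm : ∀ x, (S x : Rn n →ₗ[ℝ] Rn n).IsSymmetric) (hS : ∀ x, S x ∘L S x = A x)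
    (x ξ η : Rn n) : |⟪ξ, A x η⟫_ℝ| ≤ max lmax 0 * (‖ξ‖ * ‖η‖) := by
  have hinner : ∀ ξ η, ⟪ξ, A x η⟫_ℝ = ⟪S x ξ, S x η⟫_ℝ := by
    intro ξ η
    rw [← hS x]
    exact (hS_symm x ξ (S x η)).symm
  have hnorm : ∀ ξ, ‖S x ξ‖ ≤ Real.sqrt (max lmax 0) * ‖ξ‖ := by
    intro ξ
    refine le_of_sq_le_sq ?_ (by positivity)
    rw [mul_pow, Real.sq_sqrt (le_max_right _ _), ← real_inner_self_eq_norm_sq, ← hinner]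
    exact (hA_upper x ξ).trans (by gcongr; exact le_max_left _ _)
  rw [hinner]
  calc _ ≤ ‖S x ξ‖ * ‖S x η‖ := abs_real_inner_le_norm _ _
    _ ≤ (Real.sqrt (max lmax 0) * ‖ξ‖) * (Real.sqrt (max lmax 0) * ‖η‖) := by
      gcongr
      · exact hnorm ξ
      · exact hnorm η
    _ = Real.sqrt (max lmax 0) ^ 2 * (‖ξ‖ * ‖η‖) := by ring
    _ = _ := by rw [Real.sq_sqrt (le_max_right _ _)]

/-- Antisymmetry of α costs one sign in the second term and two, which cancel, in the third. Only A
= S² remains. -/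
theorem eqKernelLebesgue_truncWeight (hα_anti : ∀ x y, α y x = -α x y)
    (hS_symm : ∀ x, (S x : Rn n →ₗ[ℝ] Rn n).IsSymmetric) (hS : ∀ x, S x ∘L S x = A x)
    (ε : ℝ) (x y : Rn n) :
    eqKernelLebesgue (truncWeight ε (tensorWeight S ω)) α x y
      = (1 / 2 : ℝ) * ∫ z, (tripleKernel A (truncVec ω α ε) (x, y, z)
        - tripleKernel A (truncVec ω α ε) (z, y, x)
        + tripleKernel A (truncVec ω α ε) (y, x, z)) := by
  have hinner : ∀ x ξ η, ⟪S x ξ, S x η⟫_ℝ = ⟪ξ, A x η⟫_ℝ := by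
    intro x ξ η
    rw [← hS x]
    exact hS_symm x ξ (S x η)
  have hW : ∀ x y ξ, truncWeight ε (tensorWeight S ω) x y ξ = S x (truncWeight ε ω x y • ξ) := by
    intro x y ξ
    by_cases h : ε ≤ dist x y
    · simp [truncWeight, tensorWeight, h]
    · simp [truncWeight, h]
  rw [eqKernelLebesgue]
  congr 1
  refine integral_congr_ae (Eventually.of_forall fun z => ?_)
  simp only [hW, tripleKernel, truncVec, hinner]
  rw [hα_anti z x, hα_anti y z, hα_anti y x]
  simp only [smul_neg, map_neg, inner_neg_left, inner_neg_right, neg_neg]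
  have hsym : ⟪truncWeight ε ω y z • α y z, A y (truncWeight ε ω y x • α y x)⟫_ℝ
      = ⟪truncWeight ε ω y x • α y x, A y (truncWeight ε ω y z • α y z)⟫_ℝ := by
    rw [← hinner, ← hinner, real_inner_comm]
  rw [hsym]
  ring

/-- S carries no measurability assumption, so the kernel is first rewritten in terms of A. -/
theorem stronglyMeasurable_eqKernelLebesgue (hω : Measurable (Function.uncurry ω))
    (hα : Measurable (Function.uncurry α)) (hα_anti : ∀ x y, α y x = -α x y)
    (hA : Measurable A) (hS_symm : ∀ x, (S x : Rn n →ₗ[ℝ] Rn n).IsSymmetric)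
    (hS : ∀ x, S x ∘L S x = A x) (ε : ℝ) :
    StronglyMeasurable fun p : Rn n × Rn n =>
      eqKernelLebesgue (truncWeight ε (tensorWeight S ω)) α p.1 p.2 := by
  simp only [eqKernelLebesgue_truncWeight hα_anti hS_symm hS]
  have hK := measurable_tripleKernel (measurable_truncVec hω hα ε) hA
  refine StronglyMeasurable.const_mul ?_ _
  refine StronglyMeasurable.integral_prod_right' (f := fun t : (Rn n × Rn n) × Rn n =>
    tripleKernel A (truncVec ω α ε) (t.1.1, t.1.2, t.2)
      - tripleKernel A (truncVec ω α ε) (t.2, t.1.2, t.1.1)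
      + tripleKernel A (truncVec ω α ε) (t.1.2, t.1.1, t.2)) (Measurable.stronglyMeasurable ?_)
  refine ((hK.comp ?_).sub (hK.comp ?_)).add (hK.comp ?_)
  · exact measurable_fst.fst.prodMk (measurable_fst.snd.prodMk measurable_snd)
  · exact measurable_snd.prodMk (measurable_fst.snd.prodMk measurable_fst.fst)
  · exact measurable_fst.snd.prodMk (measurable_fst.fst.prodMk measurable_snd)

/-- A sequence of truncation radii that tends to zero. -/
def truncRadius (k : ℕ) : ℝ := 1 / ((k : ℝ) + 1)

theorem truncRadius_pos (k : ℕ) : 0 < truncRadius k := Nat.one_div_pos_of_nat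

theorem tendsto_truncRadius : Tendsto truncRadius atTop (𝓝[>] 0) :=
  tendsto_nhdsWithin_iff.2 ⟨tendsto_one_div_add_atTop_nhds_zero_nat,
    Eventually.of_forall truncRadius_pos⟩

theorem IntegralsConverge.tripleEnergy_lt_top (hconv : IntegralsConverge S ω α Ω) {v : L2 n}
    (hv : v ∈ energySubmodule (eqKernel (tensorWeight S ω) α) Ω) {ε : ℝ} (hε : 0 < ε) :
    tripleEnergy (truncVec ω α ε) v < ∞ :=
  hconv.truncated v hv ε hε

theorem IntegralsConverge.memLp_weightedGrad (hconv : IntegralsConverge S ω α Ω)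
    (hω : Measurable (Function.uncurry ω)) (hα : Measurable (Function.uncurry α)) {v : L2 n}
    (hv : v ∈ energySubmodule (eqKernel (tensorWeight S ω) α) Ω) {ε : ℝ} (hε : 0 < ε) :
    MemLp (weightedGrad (truncWeight ε ω) α v) 2 := by
  have : weightedGrad (truncWeight ε ω) α v
      = fun x => ∫ y, (v y - v x) • truncVec ω α ε x y :=
    funext fun x => weightedGrad_truncWeight v ε x
  rw [this]
  exact memLp_gradient (measurable_truncVec hω hα ε) (Lp.stronglyMeasurable v).measurable
    (hconv.tripleEnergy_lt_top hv hε)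

theorem IntegralsConverge.memLp_pvGrad (hconv : IntegralsConverge S ω α Ω)
    (hω : Measurable (Function.uncurry ω)) (hα : Measurable (Function.uncurry α)) {v : L2 n}
    (hv : v ∈ energySubmodule (eqKernel (tensorWeight S ω) α) Ω) :
    MemLp (pvGrad ω α v) 2 := by
  have hG := fun k => hconv.memLp_weightedGrad hω hα hv (truncRadius_pos k)
  have hm : AEStronglyMeasurable (pvGrad ω α v) volume :=
    aestronglyMeasurable_of_tendsto_ae atTop (fun k => (hG k).aestronglyMeasurable)
      ((hconv.gradient v hv).mono fun x hx => hx.comp tendsto_truncRadius)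
  obtain ⟨k, hk⟩ := (((hconv.gradient_L2 v hv).comp tendsto_truncRadius).eventually_lt_const
    (show (0 : ℝ≥0∞) < 1 by norm_num)).exists
  have hd : MemLp (fun x => weightedGrad (truncWeight (truncRadius k) ω) α v x - pvGrad ω α v x) 2
      volume := ⟨(hG k).aestronglyMeasurable.sub hm, hk.trans (by norm_num)⟩
  have := (hG k).sub hd
  refine this.ae_eq (Eventually.of_forall fun x => ?_)
  simp

/-- A acts boundedly on L², so both factors converge in L² and the inner product of L² is
continuous. -/
theorem IntegralsConverge.tendsto_anisotropic_energy (hconv : IntegralsConverge S ω α Ω)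
    (hω : Measurable (Function.uncurry ω)) (hα : Measurable (Function.uncurry α))
    (hA : Measurable A) {Λ : ℝ} (hΛ : ∀ x ξ η, |⟪ξ, A x η⟫_ℝ| ≤ Λ * (‖ξ‖ * ‖η‖)) {u v : L2 n}
    (hu : u ∈ energySubmodule (eqKernel (tensorWeight S ω) α) Ω)
    (hv : v ∈ energySubmodule (eqKernel (tensorWeight S ω) α) Ω) :
    Tendsto (fun k => ∫ x, ⟪weightedGrad (truncWeight (truncRadius k) ω) α v x,
      A x (weightedGrad (truncWeight (truncRadius k) ω) α u x)⟫_ℝ) atTop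
      (𝓝 (anisoForm ω α A u v)) := by
  have hAnorm : ∀ x η, ‖A x η‖ ≤ Λ * ‖η‖ := by
    intro x η
    have h := hΛ x (A x η) η
    rw [real_inner_self_eq_norm_sq, abs_of_nonneg (sq_nonneg _)] at h
    rcases (norm_nonneg (A x η)).eq_or_lt with h0 | h0
    · rw [← h0]
      rcases (norm_nonneg η).eq_or_lt with h1 | h1
      · rw [← h1, mul_zero]
      · have h2 := hΛ x η η
        have h3 : 0 ≤ Λ * (‖η‖ * ‖η‖) := (abs_nonneg _).trans h2
        by_contra hneg
        rw [not_le] at hneg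
        nlinarith
    · refine le_of_mul_le_mul_left ?_ h0
      linarith
  have hAm : ∀ g : Rn n → Rn n, AEStronglyMeasurable g volume →
      AEStronglyMeasurable (fun x => A x (g x)) volume := by
    intro g hg
    have hg' := hg.aemeasurable
    refine (measurable_clm_apply₂ hA hg'.measurable_mk).aestronglyMeasurable.congr ?_
    filter_upwards [hg'.ae_eq_mk] with x hx
    rw [hx]
  have hAL : ∀ g : Rn n → Rn n, MemLp g 2 volume → MemLp (fun x => A x (g x)) 2 volume :=
    fun g hg => hg.of_le_mul (hAm g hg.aestronglyMeasurable)
      (Eventually.of_forall fun x => hAnorm x (g x))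
  have hGu := fun k => hconv.memLp_weightedGrad hω hα hu (truncRadius_pos k)
  have hGv := fun k => hconv.memLp_weightedGrad hω hα hv (truncRadius_pos k)
  have hPu := hconv.memLp_pvGrad hω hα hu
  have hPv := hconv.memLp_pvGrad hω hα hv
  have tv := (Lp.tendsto_Lp_iff_tendsto_eLpNorm'' _ hGv _ hPv).2
    ((hconv.gradient_L2 v hv).comp tendsto_truncRadius)
  have tu := (Lp.tendsto_Lp_iff_tendsto_eLpNorm''
    (fun k x => A x (weightedGrad (truncWeight (truncRadius k) ω) α u x))
    (fun k => hAL _ (hGu k)) (fun x => A x (pvGrad ω α u x)) (hAL _ hPu)).2 (by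
      have h0 := ENNReal.Tendsto.const_mul ((hconv.gradient_L2 u hu).comp tendsto_truncRadius)
        (Or.inr (ENNReal.ofReal_ne_top (r := Λ)))
      rw [mul_zero] at h0
      refine tendsto_of_tendsto_of_tendsto_of_le_of_le tendsto_const_nhds h0
        (fun k => zero_le) fun k => ?_
      refine eLpNorm_le_mul_eLpNorm_of_ae_le_mul (Eventually.of_forall fun x => ?_) 2
      rw [Pi.sub_apply, ← map_sub]
      exact hAnorm x _)
  have hinner : ∀ (g h : Rn n → Rn n) (hg : MemLp g 2 volume) (hh : MemLp h 2 volume),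
      ⟪hg.toLp g, hh.toLp h⟫_ℝ = ∫ x, ⟪g x, h x⟫_ℝ := by
    intro g h hg hh
    rw [L2.inner_def]
    refine integral_congr_ae ?_
    filter_upwards [hg.coeFn_toLp, hh.coeFn_toLp] with x h1 h2
    rw [h1, h2]
  have := tv.inner (𝕜 := ℝ) tu
  simpa only [hinner, anisoForm] using this

theorem enorm_two_point_mul_le {s p q : ℝ} {g : ℝ≥0∞} (hs : ‖s‖ₑ ≤ g) :
    ‖p * q * s‖ₑ ≤ ‖p‖ₑ ^ 2 * g + ‖q‖ₑ ^ 2 * g := by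
  rw [enorm_mul, ← add_mul]
  refine mul_le_mul' ?_ hs
  have h : |p * q| ≤ p ^ 2 + q ^ 2 := by
    rw [abs_le]; constructor <;> nlinarith [sq_nonneg (p + q), sq_nonneg (p - q)]
  calc ‖p * q‖ₑ = ENNReal.ofReal |p * q| := by
        rw [← Real.norm_eq_abs, ofReal_norm]
    _ ≤ ENNReal.ofReal (p ^ 2 + q ^ 2) := ENNReal.ofReal_le_ofReal h
    _ = ‖p‖ₑ ^ 2 + ‖q‖ₑ ^ 2 := by
        rw [ENNReal.ofReal_add (sq_nonneg _) (sq_nonneg _), ← enorm_pow, ← enorm_pow,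
          Real.enorm_of_nonneg (sq_nonneg p), Real.enorm_of_nonneg (sq_nonneg q)]

theorem aestronglyMeasurable_eqKernel (hconv : IntegralsConverge S ω α Ω) (hω : Measurable (Function.uncurry ω))
    (hα : Measurable (Function.uncurry α)) (hα_anti : ∀ x y, α y x = -α x y)
    (hA : Measurable A) (hS_symm : ∀ x, (S x : Rn n →ₗ[ℝ] Rn n).IsSymmetric)
    (hS : ∀ x, S x ∘L S x = A x) : AEStronglyMeasurable
    (fun p : Rn n × Rn n => eqKernel (tensorWeight S ω) α p.1 p.2) volume :=
  aestronglyMeasurable_of_tendsto_ae atTop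
    (fun k => (stronglyMeasurable_eqKernelLebesgue hω hα hα_anti hA hS_symm hS
      (truncRadius k)).aestronglyMeasurable)
    (hconv.kernel.mono fun _ hp => hp.comp tendsto_truncRadius)

/-- The integrand of the unweighted form is integrable, and the truncated forms converge. -/
theorem tendsto_truncated_unweightedForm (hconv : IntegralsConverge S ω α Ω) (hω : Measurable (Function.uncurry ω))
    (hα : Measurable (Function.uncurry α)) (hα_anti : ∀ x y, α y x = -α x y)
    (hA : Measurable A) (hS_symm : ∀ x, (S x : Rn n →ₗ[ℝ] Rn n).IsSymmetric)
    (hS : ∀ x, S x ∘L S x = A x) {u v : L2 n}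
    (hu : u ∈ energySubmodule (eqKernel (tensorWeight S ω) α) Ω)
    (hv : v ∈ energySubmodule (eqKernel (tensorWeight S ω) α) Ω) :
    Integrable (fun p : Rn n × Rn n => (u p.2 - u p.1) * (v p.2 - v p.1)
      * eqKernel (tensorWeight S ω) α p.1 p.2) ∧
    Tendsto (fun k => ∫ p : Rn n × Rn n, (u p.2 - u p.1) * (v p.2 - v p.1)
      * eqKernelLebesgue (truncWeight (truncRadius k) (tensorWeight S ω)) α p.1 p.2) atTop
      (𝓝 (unweightedForm (eqKernel (tensorWeight S ω) α) u v)) := by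
  obtain ⟨g, hg, hle, hfin⟩ := hconv.majorant
  have hum := (Lp.stronglyMeasurable u).measurable
  have hvm := (Lp.stronglyMeasurable v).measurable
  have hdu : Measurable fun p : Rn n × Rn n => u p.2 - u p.1 :=
    (hum.comp measurable_snd).sub (hum.comp measurable_fst)
  have hdv : Measurable fun p : Rn n × Rn n => v p.2 - v p.1 :=
    (hvm.comp measurable_snd).sub (hvm.comp measurable_fst)
  have hum' : Measurable fun p : Rn n × Rn n => ‖u p.2 - u p.1‖ₑ ^ 2 * g p :=
    (hdu.enorm.pow_const 2).mul hg
  have hvm' : Measurable fun p : Rn n × Rn n => ‖v p.2 - v p.1‖ₑ ^ 2 * g p :=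
    (hdv.enorm.pow_const 2).mul hg
  let bd : Rn n × Rn n → ℝ≥0∞ := fun p =>
    ‖u p.2 - u p.1‖ₑ ^ 2 * g p + ‖v p.2 - v p.1‖ₑ ^ 2 * g p
  have hbd : ∫⁻ p, bd p ≠ ∞ := by
    rw [lintegral_add_left hum']
    exact ENNReal.add_ne_top.2 ⟨(hfin u hu).ne, (hfin v hv).ne⟩
  have hbdm : Measurable bd := hum'.add hvm'
  have hbdi : Integrable fun p => (bd p).toReal :=
    integrable_toReal_of_lintegral_ne_top hbdm.aemeasurable hbd
  have hbound : ∀ {κ : Rn n × Rn n → ℝ}, (∀ᵐ p, ‖κ p‖ₑ ≤ g p) →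
      ∀ᵐ p, ‖(u p.2 - u p.1) * (v p.2 - v p.1) * κ p‖ ≤ (bd p).toReal := by
    intro κ hκ
    filter_upwards [hκ, ae_lt_top hbdm hbd] with p h1 h2
    rw [← toReal_enorm]
    exact ENNReal.toReal_mono h2.ne (enorm_two_point_mul_le h1)
  have hle' : ∀ᶠ k in atTop, ∀ᵐ p : Rn n × Rn n,
      ‖eqKernelLebesgue (truncWeight (truncRadius k) (tensorWeight S ω)) α p.1 p.2‖ₑ ≤ g p :=
    tendsto_truncRadius.eventually hle
  have hlim : ∀ᵐ p : Rn n × Rn n, Tendsto (fun k =>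
      eqKernelLebesgue (truncWeight (truncRadius k) (tensorWeight S ω)) α p.1 p.2) atTop
      (𝓝 (eqKernel (tensorWeight S ω) α p.1 p.2)) :=
    hconv.kernel.mono fun _ hp => hp.comp tendsto_truncRadius
  -- Countably many radii share one null set, so the majorant passes to the limit kernel.
  have hγ : ∀ᵐ p : Rn n × Rn n, ‖eqKernel (tensorWeight S ω) α p.1 p.2‖ₑ ≤ g p := by
    obtain ⟨N, hN⟩ := eventually_atTop.1 hle'
    have hall : ∀ᵐ p : Rn n × Rn n, ∀ k, N ≤ k →
        ‖eqKernelLebesgue (truncWeight (truncRadius k) (tensorWeight S ω)) α p.1 p.2‖ₑ ≤ g p := by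
      rw [ae_all_iff]
      intro k
      by_cases hk : N ≤ k
      · filter_upwards [hN k hk] with p hp _ using hp
      · exact Eventually.of_forall fun p h => absurd h hk
    filter_upwards [hall, hlim] with p h1 h2
    exact le_of_tendsto h2.enorm (eventually_atTop.2 ⟨N, h1⟩)
  refine ⟨hbdi.mono' ((hdu.mul hdv).aestronglyMeasurable.mul
    (aestronglyMeasurable_eqKernel hconv hω hα hα_anti hA hS_symm hS)) (hbound hγ), ?_⟩
  refine tendsto_integral_filter_of_dominated_convergence (fun p => (bd p).toReal)
    (Eventually.of_forall fun k => (hdu.mul hdv).aestronglyMeasurable.mul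
      (stronglyMeasurable_eqKernelLebesgue hω hα hα_anti hA hS_symm hS
        (truncRadius k)).aestronglyMeasurable) (hle'.mono fun k hk => hbound hk) hbdi ?_
  filter_upwards [hlim] with p hp
  exact hp.const_mul _

/-- The anisotropic weighted form is the unweighted form of the equivalence kernel. -/
theorem anisoForm_eq_unweightedForm (hconv : IntegralsConverge S ω α Ω) (hω : Measurable (Function.uncurry ω))
    (hα : Measurable (Function.uncurry α)) (hα_anti : ∀ x y, α y x = -α x y)
    (hA : Measurable A) (hS_symm : ∀ x, (S x : Rn n →ₗ[ℝ] Rn n).IsSymmetric)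
    (hS : ∀ x, S x ∘L S x = A x)
    (hA_symm : ∀ x, (A x : Rn n →ₗ[ℝ] Rn n).IsSymmetric)
    {lmax : ℝ} (hA_upper : ∀ x ξ, ⟪ξ, A x ξ⟫_ℝ ≤ lmax * ‖ξ‖ ^ 2) {u v : L2 n}
    (hu : u ∈ energySubmodule (eqKernel (tensorWeight S ω) α) Ω)
    (hv : v ∈ energySubmodule (eqKernel (tensorWeight S ω) α) Ω) :
    anisoForm ω α A u v = unweightedForm (eqKernel (tensorWeight S ω) α) u v := by
  have hΛ := abs_inner_le_of_sqrt hA_upper hS_symm hS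
  refine tendsto_nhds_unique (hconv.tendsto_anisotropic_energy hω hα hA hΛ hu hv)
    ((tendsto_truncated_unweightedForm hconv hω hα hα_anti hA hS_symm hS hu hv).2.congr
      fun k => ?_)
  simp only [weightedGrad_truncWeight, eqKernelLebesgue_truncWeight hα_anti hS_symm hS]
  exact (integral_inner_gradient_eq (measurable_truncVec hω hα _) hA hA_symm hΛ
    (Lp.stronglyMeasurable u).measurable (Lp.stronglyMeasurable v).measurable
    (hconv.tripleEnergy_lt_top hu (truncRadius_pos k))
    (hconv.tripleEnergy_lt_top hv (truncRadius_pos k))).symm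

end EquivalenceIdentity

end

noncomputable section

/-! ### Completeness of the energy space and the bounded form on it. -/

section EnergySpaceComplete

variable {n : ℕ} {γ : Rn n → Rn n → ℝ} {Ω : Set (Rn n)}

theorem norm_toL2_le (v : EnergySpace γ Ω) : ‖v.toL2‖ ≤ ‖v‖ :=
  le_of_sq_le_sq (by rw [EnergySpace.norm_sq_eq]; nlinarith [sq_nonneg (energyNorm v)])
    (norm_nonneg v)

theorem energyNorm_le_norm (v : EnergySpace γ Ω) : energyNorm v ≤ ‖v‖ :=
  le_of_sq_le_sq (by rw [EnergySpace.norm_sq_eq]; nlinarith [sq_nonneg ‖v.toL2‖]) (norm_nonneg v)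

/-- The inclusion of the energy space in `L²`, as a continuous linear map. -/
def EnergySpace.toL2L (γ : Rn n → Rn n → ℝ) (Ω : Set (Rn n)) : EnergySpace γ Ω →L[ℝ] L2 n :=
  EnergySpace.toL2.mkContinuous 1 fun v => by simpa using norm_toL2_le v

/-- The two-point difference of a function in the energy space, as a square integrable function
with respect to `|γ(x,y)| dy dx`. -/
def EnergySpace.diffL (γ : Rn n → Rn n → ℝ) (Ω : Set (Rn n)) :
    EnergySpace γ Ω →ₗ[ℝ] Lp ℝ 2 (kernelMeasure γ) where
  toFun v := (show MemLp (twoPointDiff v.toL2) 2 (kernelMeasure γ) from v.2.2).toLp _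
  map_add' u v := by
    rw [← MemLp.toLp_add]
    exact MemLp.toLp_congr _ _ (twoPointDiff_add γ u.toL2 v.toL2)
  map_smul' c u := by
    rw [RingHom.id_apply, ← MemLp.toLp_const_smul]
    exact MemLp.toLp_congr _ _ (twoPointDiff_smul γ c u.toL2)

theorem EnergySpace.coeFn_diffL (v : EnergySpace γ Ω) :
    EnergySpace.diffL γ Ω v =ᵐ[kernelMeasure γ] twoPointDiff v.toL2 :=
  (show MemLp (twoPointDiff v.toL2) 2 (kernelMeasure γ) from v.2.2).coeFn_toLp

theorem EnergySpace.norm_diffL (v : EnergySpace γ Ω) : ‖EnergySpace.diffL γ Ω v‖ = energyNorm v := by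
  have hv : MemLp (twoPointDiff v.toL2) 2 (kernelMeasure γ) := v.2.2
  change ‖hv.toLp _‖ = _
  rw [Lp.norm_toLp, eLpNorm_two_eq_ofReal_sqrt hv, ENNReal.toReal_ofReal (Real.sqrt_nonneg _)]
  simp only [Real.norm_eq_abs, sq_abs, energyNorm]

/-- The energy norm is the norm of the linear map `EnergySpace.diffL`, hence a seminorm bounded by
the full norm. -/
theorem lipschitzWith_energyNorm : LipschitzWith 1 (energyNorm : EnergySpace γ Ω → ℝ) := by
  refine LipschitzWith.of_dist_le_mul fun u v => ?_
  rw [NNReal.coe_one, one_mul, dist_eq_norm, dist_eq_norm, Real.norm_eq_abs,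
    ← EnergySpace.norm_diffL u, ← EnergySpace.norm_diffL v]
  refine (abs_norm_sub_norm_le _ _).trans ?_
  rw [← map_sub, EnergySpace.norm_diffL]
  exact energyNorm_le_norm _

theorem energyNorm_zero : energyNorm (0 : EnergySpace γ Ω) = 0 := by
  rw [← EnergySpace.norm_diffL, map_zero, norm_zero]

/-- A Cauchy sequence converges in L², and its two-point differences converge in L² of |γ| dy dx.
Nested subsequences converge almost everywhere in both senses and show that the second limit is the
difference of the first; null sets of points carry over to pairs because |γ| dy dx is absolutely
continuous. -/
instance : CompleteSpace (EnergySpace γ Ω) := by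
  refine Metric.complete_of_cauchySeq_tendsto fun a ha => ?_
  have h1 : CauchySeq fun k => (a k).toL2 :=
    (EnergySpace.toL2L γ Ω).uniformContinuous.comp_cauchySeq ha
  have h2 : CauchySeq fun k => EnergySpace.diffL γ Ω (a k) := by
    refine (EnergySpace.diffL γ Ω).mkContinuous 1 (fun v => ?_)
      |>.uniformContinuous.comp_cauchySeq ha
    rw [one_mul, EnergySpace.norm_diffL]
    exact energyNorm_le_norm v
  obtain ⟨v, hv⟩ := cauchySeq_tendsto_of_complete h1
  obtain ⟨h, hh⟩ := cauchySeq_tendsto_of_complete h2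
  obtain ⟨ns, hns, hae⟩ := (tendstoInMeasure_of_tendsto_Lp hv).exists_seq_tendsto_ae
  obtain ⟨ms, hms, hae'⟩ := (tendstoInMeasure_of_tendsto_Lp
    (hh.comp hns.tendsto_atTop)).exists_seq_tendsto_ae
  have hdiff : twoPointDiff v =ᵐ[kernelMeasure γ] h := by
    have e1 : ∀ᵐ p ∂(kernelMeasure γ), Tendsto (fun k => (a (ns k)).toL2 p.1) atTop (𝓝 (v p.1)) :=
      (withDensity_absolutelyContinuous _ _).ae_le
        ((Measure.quasiMeasurePreserving_fst (μ := volume) (ν := volume)).ae hae)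
    have e2 : ∀ᵐ p ∂(kernelMeasure γ), Tendsto (fun k => (a (ns k)).toL2 p.2) atTop (𝓝 (v p.2)) :=
      (withDensity_absolutelyContinuous _ _).ae_le
        ((Measure.quasiMeasurePreserving_snd (μ := volume) (ν := volume)).ae hae)
    have e3 : ∀ᵐ p ∂(kernelMeasure γ), ∀ k,
        EnergySpace.diffL γ Ω (a k) p = twoPointDiff (a k).toL2 p :=
      ae_all_iff.2 fun k => EnergySpace.coeFn_diffL (a k)
    filter_upwards [e1, e2, e3, hae'] with p h1 h2 h3 h4
    refine tendsto_nhds_unique ((h2.sub h1).comp hms.tendsto_atTop) (h4.congr fun k => ?_)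
    exact h3 _
  have hvmem : v ∈ energySubmodule γ Ω := by
    refine ⟨?_, (memLp_congr_ae hdiff).2 (Lp.memLp h)⟩
    have hzero : ∀ᵐ x, ∀ k, x ∉ Ω → (a k).toL2 x = 0 := ae_all_iff.2 fun k => (a k).2.1
    filter_upwards [hae, hzero] with x h1 h2 hx
    refine tendsto_nhds_unique h1 ?_
    simp only [h2 _ hx, tendsto_const_nhds]
  let v' : EnergySpace γ Ω := ⟨v, hvmem⟩
  have hv' : EnergySpace.diffL γ Ω v' = h :=
    Lp.ext ((EnergySpace.coeFn_diffL v').trans hdiff)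
  refine ⟨v', ?_⟩
  rw [tendsto_iff_norm_sub_tendsto_zero]
  have hsq : Tendsto (fun k => ‖(a k).toL2 - v‖ ^ 2 + ‖EnergySpace.diffL γ Ω (a k) - h‖ ^ 2) atTop
      (𝓝 0) := by
    simpa using ((tendsto_iff_norm_sub_tendsto_zero.1 hv).pow 2).add
      ((tendsto_iff_norm_sub_tendsto_zero.1 hh).pow 2)
  have hnorm : ∀ k, ‖a k - v'‖
      = Real.sqrt (‖(a k).toL2 - v‖ ^ 2 + ‖EnergySpace.diffL γ Ω (a k) - h‖ ^ 2) := by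
    intro k
    rw [← hv', ← map_sub, EnergySpace.norm_diffL]
    have h3 : (a k).toL2 - v = (a k - v').toL2 := by rw [map_sub]; rfl
    rw [h3, ← EnergySpace.norm_sq_eq, Real.sqrt_sq (norm_nonneg _)]
  simp only [hnorm]
  simpa using hsq.sqrt

/-- A continuous unweighted form as a continuous bilinear form on the energy space. -/
theorem exists_clm_eq_unweightedForm (hcont : IsContinuousForm γ Ω)
    (hint : ∀ u v : EnergySpace γ Ω, Integrable fun p : Rn n × Rn n =>
      (u.toL2 p.2 - u.toL2 p.1) * (v.toL2 p.2 - v.toL2 p.1) * γ p.1 p.2) :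
    ∃ B : EnergySpace γ Ω →L[ℝ] StrongDual ℝ (EnergySpace γ Ω),
      ∀ u v, B u v = unweightedForm γ u.toL2 v.toL2 := by
  obtain ⟨M, hM⟩ := hcont
  have hfst : ∀ {u v : Rn n → ℝ}, u =ᵐ[volume] v → ∀ᵐ p : Rn n × Rn n, u p.1 = v p.1 := fun h =>
    (Measure.quasiMeasurePreserving_fst (μ := volume) (ν := volume)).ae h
  have hsnd : ∀ {u v : Rn n → ℝ}, u =ᵐ[volume] v → ∀ᵐ p : Rn n × Rn n, u p.2 = v p.2 := fun h =>
    (Measure.quasiMeasurePreserving_snd (μ := volume) (ν := volume)).ae h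
  have hsymm : ∀ u v : EnergySpace γ Ω,
      unweightedForm γ u.toL2 v.toL2 = unweightedForm γ v.toL2 u.toL2 := fun u v =>
    integral_congr_ae (Eventually.of_forall fun p => by ring)
  have hadd : ∀ u u' v : EnergySpace γ Ω, unweightedForm γ (u + u').toL2 v.toL2
      = unweightedForm γ u.toL2 v.toL2 + unweightedForm γ u'.toL2 v.toL2 := by
    intro u u' v
    refine Eq.trans (integral_congr_ae ?_) (integral_add (hint u v) (hint u' v))
    have h := Lp.coeFn_add u.toL2 u'.toL2
    rw [map_add]
    filter_upwards [hfst h, hsnd h] with p h1 h2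
    rw [h1, h2, Pi.add_apply, Pi.add_apply]
    ring
  have hsmul : ∀ (c : ℝ) (u v : EnergySpace γ Ω), unweightedForm γ (c • u).toL2 v.toL2
      = c • unweightedForm γ u.toL2 v.toL2 := by
    intro c u v
    refine Eq.trans (integral_congr_ae ?_) (integral_const_mul c _)
    have h := Lp.coeFn_smul c u.toL2
    rw [map_smul]
    filter_upwards [hfst h, hsnd h] with p h1 h2
    rw [h1, h2, Pi.smul_apply, Pi.smul_apply, smul_eq_mul, smul_eq_mul]
    ring
  let B₀ : EnergySpace γ Ω →ₗ[ℝ] EnergySpace γ Ω →ₗ[ℝ] ℝ :=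
    LinearMap.mk₂ ℝ (fun u v => unweightedForm γ u.toL2 v.toL2) hadd hsmul
      (fun u v v' => by rw [hsymm, hadd, hsymm v, hsymm v'])
      (fun c u v => by rw [hsymm, hsmul, hsymm v])
  exact ⟨B₀.mkContinuous₂ M hM, fun u v => rfl⟩

end EnergySpaceComplete

end

/-! ### The main theorem. -/

theorem theorem4p1 {n : ℕ} (Ω : Set (Rn n)) (hΩ : MeasurableSet Ω)
    -- the antisymmetric vector function and the nonnegative symmetric weight
    (α : Rn n → Rn n → Rn n) (hα : Measurable (Function.uncurry α))
    (hα_anti : ∀ x y, α y x = -α x y)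
    (ω : Rn n → Rn n → ℝ) (hω : Measurable (Function.uncurry ω))
    (hω_nonneg : ∀ x y, 0 ≤ ω x y) (hω_symm : ∀ x y, ω y x = ω x y)
    -- the bounded, measurable, symmetric, elliptic tensor and its square root
    (A : Rn n → Rn n →L[ℝ] Rn n) (hA : Measurable A)
    (hA_symm : ∀ x, (A x : Rn n →ₗ[ℝ] Rn n).IsSymmetric)
    (lmin lmax : ℝ) (hlmin : 0 < lmin) (hA_lower : ∀ x ξ, lmin * ‖ξ‖ ^ 2 ≤ ⟪ξ, A x ξ⟫_ℝ)
    (hA_upper : ∀ x ξ, ⟪ξ, A x ξ⟫_ℝ ≤ lmax * ‖ξ‖ ^ 2)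
    (S : Rn n → Rn n →L[ℝ] Rn n) (hS_symm : ∀ x, (S x : Rn n →ₗ[ℝ] Rn n).IsSymmetric)
    (hS : ∀ x, S x ∘L S x = A x)
    (hconv : IntegralsConverge S ω α Ω)
    -- the unweighted form of the equivalence kernel is continuous and weakly coercive
    (hB_cont : IsContinuousForm (eqKernel (tensorWeight S ω) α) Ω)
    (hB_weak : IsWeaklyCoerciveForm (eqKernel (tensorWeight S ω) α) Ω)
    -- the data
    (T : ℝ) (hT : 0 < T)
    (f : ℝ → StrongDual ℝ (EnergySpace (eqKernel (tensorWeight S ω) α) Ω))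
    (hf : MemLp f 2 (volume.restrict (Ioo 0 T)))
    (u₀ : L2 n)
    (hu₀ : u₀ ∈ closure (energySubmodule (eqKernel (tensorWeight S ω) α) Ω : Set (L2 n))) :
    ∃ u : ℝ → EnergySpace (eqKernel (tensorWeight S ω) α) Ω,
      -- existence and uniqueness
      IsWeakSolution ω α A T f u₀ u ∧
      (∀ w : ℝ → EnergySpace (eqKernel (tensorWeight S ω) α) Ω,
        IsWeakSolution ω α A T f u₀ w → w =ᵐ[volume.restrict (Ioo 0 T)] u) ∧
      -- the representative that is continuous in time with values in `L²`
      ∃ U : ℝ → L2 n, ContinuousOn U (Icc 0 T) ∧ U 0 = u₀ ∧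
        (∀ᵐ t ∂(volume.restrict (Ioo 0 T)), U t = (u t).toL2) ∧
        -- the a priori estimate
        ∀ C : ℝ, IsCoerciveForm (eqKernel (tensorWeight S ω) α) Ω C →
          (∀ Cp : ℝ, (∀ v : EnergySpace (eqKernel (tensorWeight S ω) α) Ω,
              ‖v‖ ≤ Cp * energyNorm v) →
            ∀ t ∈ Ioc 0 T, ‖U t‖ ^ 2 + C * ∫ s in Ioo 0 t, energyNorm (u s) ^ 2
              ≤ ‖u₀‖ ^ 2 + Cp ^ 2 / C * ∫ s in Ioo 0 t, ‖f s‖ ^ 2) ∧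
          (∀ Cp : ℝ, (∀ v : EnergySpace (eqKernel (tensorWeight S ω) α) Ω,
              ‖v.toL2‖ ≤ Cp * energyNorm v) →
            ∀ t ∈ Ioc 0 T, ‖U t‖ ^ 2 + C * ∫ s in Ioo 0 t, energyNorm (u s) ^ 2
              ≤ ‖u₀‖ ^ 2 + (1 + Cp ^ 2) / C * ∫ s in Ioo 0 t, ‖f s‖ ^ 2) := by
  obtain ⟨B, hBeq⟩ := exists_clm_eq_unweightedForm hB_cont fun u v =>
    (tendsto_truncated_unweightedForm hconv hω hα hα_anti hA hS_symm hS u.2 v.2).1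
  have haniso : ∀ u v : EnergySpace (eqKernel (tensorWeight S ω) α) Ω,
      anisoForm ω α A u.toL2 v.toL2 = B u v := fun u v =>
    (anisoForm_eq_unweightedForm hconv hω hα hα_anti hA hS_symm hS hA_symm hA_upper u.2 v.2).trans
      (hBeq u v).symm
  let j := EnergySpace.toL2L (eqKernel (tensorWeight S ω) α) Ω
  obtain ⟨c, hc, l, hcl⟩ := hB_weak
  -- The constant of weak coercivity may be negative; enlarging it to max l 0 keeps the inequality.
  have hl : 0 ≤ max l 0 := le_max_right _ _
  have hB : ∀ v, c * ‖v‖ ^ 2 ≤ B v v + max l 0 * ‖j v‖ ^ 2 := fun v => by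
    rw [hBeq]
    exact (hcl v).trans (add_le_add_right
      (mul_le_mul_of_nonneg_right (le_max_left _ _) (sq_nonneg _)) _)
  have hu₀' : u₀ ∈ closure (range j) := by
    have : range j = (energySubmodule (eqKernel (tensorWeight S ω) α) Ω : Set (L2 n)) :=
      Subtype.range_coe
    rwa [this]
  obtain ⟨u, hu, hweak, U, hUc, hU0, hUu, hest⟩ :=
    exists_weak_solution j B hc hl hB hT.le hf hu₀'
  refine ⟨u, ⟨hu, fun v φ h1 h2 h3 => ?_⟩, fun w hw => ?_, U, hUc, hU0, hUu, ?_⟩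
  · simp only [haniso]
    exact hweak v φ h1 h2 h3
  · have hzero : (w - u) =ᵐ[volume.restrict (Ioo 0 T)] 0 := by
      refine ae_eq_zero_of_weak_solution j B hc hl hB hT (hw.memLp.sub hu)
        fun v φ h1 h2 h3 => ?_
      have e1 := hw.weak v φ h1 h2 h3
      simp only [haniso] at e1
      have e2 := hweak v φ h1 h2 h3
      have i1 : ∀ z : ℝ → EnergySpace (eqKernel (tensorWeight S ω) α) Ω,
          MemLp z 2 (volume.restrict (Ioo 0 T)) →
          Integrable (fun t => ⟪j (z t), j v⟫_ℝ * deriv φ t) (volume.restrict (Ioo 0 T)) :=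
        fun z hz => (((massForm j).flip v).comp_memLp' hz).integrable_mul
          (h1.continuous_deriv_smooth.memLp_two_Ioo 0 T)
      have i2 : ∀ z : ℝ → EnergySpace (eqKernel (tensorWeight S ω) α) Ω,
          MemLp z 2 (volume.restrict (Ioo 0 T)) →
          Integrable (fun t => B (z t) v * φ t) (volume.restrict (Ioo 0 T)) :=
        fun z hz => ((B.flip v).comp_memLp' hz).integrable_mul
          (h1.continuous.memLp_two_Ioo 0 T)
      simp only [Pi.sub_apply, map_sub, inner_sub_left, sub_apply, sub_mul]
      rw [integral_sub (i1 w hw.memLp) (i1 u hu), integral_sub (i2 w hw.memLp) (i2 u hu)]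
      have e3 : ∫ t in Ioo 0 T, ⟪(w t).toL2, v.toL2⟫_ℝ * deriv φ t
          = ∫ t in Ioo 0 T, ⟪j (w t), j v⟫_ℝ * deriv φ t := rfl
      have e4 : ⟪u₀, v.toL2⟫_ℝ = ⟪u₀, j v⟫_ℝ := rfl
      rw [e3, e4] at e1
      linarith
    filter_upwards [hzero] with t ht
    exact sub_eq_zero.1 ht
  · rintro C ⟨hC, hCoer⟩
    have hCe : ∀ v, C * energyNorm v ^ 2 ≤ B v v := fun v => by rw [hBeq]; exact hCoer v
    refine ⟨fun Cp hCp => ?_, fun Cp hCp => ?_⟩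
    · refine hest C (Cp ^ 2) energyNorm hC (sq_nonneg _) lipschitzWith_energyNorm energyNorm_zero
        hCe fun v => ?_
      rw [← mul_pow]
      exact pow_le_pow_left₀ (norm_nonneg v) (hCp v) 2
    · refine hest C (1 + Cp ^ 2) energyNorm hC (by positivity) lipschitzWith_energyNorm
        energyNorm_zero hCe fun v => ?_
      have h1 := pow_le_pow_left₀ (norm_nonneg v.toL2) (hCp v) 2
      rw [mul_pow] at h1
      -- Here 1 is the contribution of the energy norm itself to the full norm.
      rw [EnergySpace.norm_sq_eq]
      linarith
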